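/- Let $A$ be a finite discrete alphabet. A shift space $X\subseteq A^{\mathbb Z}$ is a closed set invariant under the shift $\sigma(x)_i=x_{i+1}$ (and its inverse); it is sofic if it is the image of a shift of finite type under a factor map (a continuous, surjective, shift-commuting map). Flow equivalence of shift spaces is the equivalence relation generated by conjugacy (the existence of a bijective continuous shift-commuting map) and symbol expansion (replacing $X$ by the set of all sequences obtained from points of $X$ by inserting a new symbol $\bullet$ after each occurrence of one fixed letter $a$). For a shift-invariant set of bi-infinite sequences $Y$ over a discrete alphabet let $SY=(Y\times\mathbb R)/\langle (x,t+1)\sim(\sigma x,t)\rangle$ be its suspension, with the flow $[x,t]\mapsto[x,t+s]$. A flow equivalence $\varphi\colon Y\to Z$ is a homeomorphism $\varphi\colon SY\to SZ$ that maps flow lines onto flow lines preserving their direction. A shift-commuting map $\pi\colon Y\to Z$ is identified with the map $SY\to SZ$, $[x,t]\mapsto[\pi(x),t]$. Let $X$ be a sofic shift. For a right-ray $x^+$ of $X$ let $P_\infty(x^+)=\{y^- : y^-x^+\in X\}$. The left Krieger cover $(K,\mathcal L_K)$ has vertex set $K^0=\{P_\infty(x^+) : x^+\in X^+\}$ and,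 for $P,P'\in K^0$ and $a\in A$, one edge labelled $a$ from $P$ to $P'$ exactly when $P=P_\infty(ax^+)$ and $P'=P_\infty(x^+)$ for some $x^+\in X^+$. A vertex $P\in K^0$ is non-decomposable if $P\in V$ whenever $V\subseteq K^0$ and $P=\bigcup_{Q\in V}Q$. The generalized left Fischer cover $(G,\mathcal L_G)$ of $X$ is the labelled subgraph of the left Krieger cover induced by the set of all $P\in K^0$ from which there is a path (possibly of length $0$) in $K$ to some non-decomposable $P'\in K^0$. Let $\mathsf X_G$ be its edge shift, i.e. the set of bi-infinite paths in $G$, and let the covering map $\pi\colon\mathsf X_G\to X$ send a path to its sequence of labels. Theorem. Let $X_1,X_2$ be flow equivalent sofic shifts with generalized left Fischer covers $(G_1,\mathcal L_1)$, $(G_2,\mathcal L_2)$ and covering maps $\pi_1\colon\mathsf X_{G_1}\to X_1$, $\pi_2\colon\mathsf X_{G_2}\to X_2$. Then $\pi_1$ and $\pi_2$ are flow equivalent: there exist flow equivalences $\varphi\colon X_1\to X_2$ and $\psi\colon\mathsf X_{G_1}\to\mathsf X_{G_2}$ such that $\varphi\circ\pi_1=\pi_2\circ\psi$ as maps $S\mathsf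 X_{G_1}\to SX_2$. -/

import Mathlib

open SymbolicDynamics.FullShift

universe u

/-! ### Shift spaces -/

/-- A shift space: a closed shift-invariant set of bi-infinite sequences over a finite discrete
alphabet. The shift map is `shift 1`, that is `(shift 1 x) i = x (1 + i)`. -/
structure ShiftSpace : Type (u + 1) where
  Alphabet : Type u
  [topAlphabet : TopologicalSpace Alphabet]
  [discreteAlphabet : DiscreteTopology Alphabet]
  [finiteAlphabet : Finite Alphabet]
  toSubshift : Subshift Alphabet ℤ

attribute [instance] ShiftSpace.topAlphabet ShiftSpace.discreteAlphabet ShiftSpace.finiteAlphabet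

namespace ShiftSpace

/-- The set of points of a shift space. -/
def points (X : ShiftSpace.{u}) : Set (ℤ → X.Alphabet) := X.toSubshift.carrier

/-- The shift map on the points of a shift space. -/
def shiftMap (X : ShiftSpace.{u}) (x : X.points) : X.points :=
  ⟨shift 1 x.1, X.toSubshift.mapsTo 1 x.2⟩

/-- A finite word occurs in a bi-infinite sequence. -/
def Occurs {A : Type u} (w : List A) (x : ℤ → A) : Prop :=
  ∃ i : ℤ, ∀ j : Fin w.length, x (i + (j : ℕ)) = w.get j

/-- Shifts of finite type: defined by a finite set of forbidden words. -/
def IsSFT (X : ShiftSpace.{u}) : Prop :=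
  ∃ F : Set (List X.Alphabet), F.Finite ∧ X.points = {x | ∀ w ∈ F, ¬ Occurs w x}

/-- Factor maps: continuous, surjective and shift commuting. -/
structure IsFactorMap {X Y : ShiftSpace.{u}} (f : X.points → Y.points) : Prop where
  continuous : Continuous f
  surjective : Function.Surjective f
  shift_commuting : ∀ x, f (X.shiftMap x) = Y.shiftMap (f x)

/-- A shift space is sofic if it is the image of a shift of finite type under a factor map. -/
def IsSofic (X : ShiftSpace.{u}) : Prop :=
  ∃ (Y : ShiftSpace.{u}) (f : Y.points → X.points), Y.IsSFT ∧ IsFactorMap f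

/-- `X` and `Y` are conjugate: there is a bijective, continuous, shift commuting map. -/
def Conjugate (X Y : ShiftSpace.{u}) : Prop :=
  ∃ f : X.points → Y.points,
    Function.Bijective f ∧ Continuous f ∧ ∀ x, f (X.shiftMap x) = Y.shiftMap (f x)

/-- `y` is obtained from `x` by renaming letters along `ι` and inserting the letter `b` after each
occurrence of `a`; the letter `x j` ends up at position `k j` of `y`. -/
def IsExpansionOf {A B : Type u} (a : A) (ι : A → B) (b : B) (x : ℤ → A) (y : ℤ → B) : Prop :=
  ∃ k : ℤ → ℤ,
    (∀ j, y (k j) = ι (x j)) ∧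
    (∀ j, x j ≠ a → k (j + 1) = k j + 1) ∧
    (∀ j, x j = a → k (j + 1) = k j + 2 ∧ y (k j + 1) = b)

/-- `Y` is obtained from `X` by a symbol expansion: for some letter `a` of the alphabet of `X` and
some new symbol `b`, the points of `Y` are the sequences obtained from points of `X` by inserting
`b` after each `a`. -/
def IsSymbolExpansion (X Y : ShiftSpace.{u}) : Prop :=
  ∃ (a : X.Alphabet) (ι : X.Alphabet → Y.Alphabet) (b : Y.Alphabet),
    Function.Injective ι ∧ b ∉ Set.range ι ∧
      Y.points = {y | ∃ x ∈ X.points, IsExpansionOf a ι b x y}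

/-- Flow equivalence of shift spaces: the equivalence relation generated by conjugacy and symbol
expansion. -/
def FlowEquivalent (X Y : ShiftSpace.{u}) : Prop :=
  Relation.EqvGen (fun X Y : ShiftSpace.{u} => Conjugate X Y ∨ IsSymbolExpansion X Y) X Y

end ShiftSpace

/-! ### Suspensions and flow equivalences -/

/-- The relation on `X × ℝ` generated by `(x, t + 1) ∼ (σ x, t)`, where `σ` is the shift map. -/
def suspensionSetoid {A : Type u} (X : Set (ℤ → A)) : Setoid (X × ℝ) where
  r p q := ∃ n : ℤ, (q.1 : ℤ → A) = shift n (p.1 : ℤ → A) ∧ q.2 = p.2 - n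
  iseqv :=
    { refl := fun p => ⟨0, by simp, by simp⟩
      symm := by
        rintro p q ⟨n, h, h'⟩
        refine ⟨-n, ?_, ?_⟩
        · rw [h, ← shift_add]; simp
        · rw [h']; push_cast; ring
      trans := by
        rintro p q s ⟨n, h, h'⟩ ⟨m, g, g'⟩
        refine ⟨n + m, ?_, ?_⟩
        · rw [g, h, ← shift_add]
        · rw [g', h']; push_cast; ring }

/-- The suspension (mapping torus) of a shift-invariant set of bi-infinite sequences, with the
quotient topology of `X × ℝ`. -/
def Suspension {A : Type u} (X : Set (ℤ → A)) : Type u := Quotient (suspensionSetoid X)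

instance {A : Type u} [TopologicalSpace A] (X : Set (ℤ → A)) : TopologicalSpace (Suspension X) :=
  inferInstanceAs (TopologicalSpace (Quotient (suspensionSetoid X)))

namespace Suspension

/-- The class of `(x, t)`. -/
def mk {A : Type u} {X : Set (ℤ → A)} (x : X) (t : ℝ) : Suspension X :=
  Quotient.mk (suspensionSetoid X) (x, t)

/-- The suspension flow: `s` sends the class of `(x, t)` to the class of `(x, t + s)`. -/
def flow {A : Type u} {X : Set (ℤ → A)} (s : ℝ) : Suspension X → Suspension X :=
  Quotient.map (sa := suspensionSetoid X) (sb := suspensionSetoid X)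
    (fun p : X × ℝ => (p.1, p.2 + s)) (by
      rintro p q ⟨n, h, h'⟩
      exact ⟨n, h, by simp only [h']; ring⟩)

/-- The map of suspensions, class of `(x, t)` to class of `(f x, t)`, induced by a map that
commutes with all powers of the shift map. -/
def map {A B : Type u} {X : Set (ℤ → A)} {Y : Set (ℤ → B)} (f : X → Y)
    (hf : ∀ (n : ℤ) (x x' : X), (x' : ℤ → A) = shift n (x : ℤ → A) →
      (f x' : ℤ → B) = shift n (f x : ℤ → B)) : Suspension X → Suspension Y :=
  Quotient.map (sa := suspensionSetoid X) (sb := suspensionSetoid Y)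
    (fun p : X × ℝ => (f p.1, p.2)) (by
      rintro p q ⟨n, h, h'⟩
      exact ⟨n, hf n _ _ h, h'⟩)

end Suspension

/-- A flow equivalence from `X` to `Y`: a homeomorphism of suspensions that maps flow lines onto
flow lines and preserves their direction, that is, along each flow line it is an increasing
reparametrization of time. -/
def IsFlowEquivalence {A B : Type u} [TopologicalSpace A] [TopologicalSpace B]
    {X : Set (ℤ → A)} {Y : Set (ℤ → B)} (h : Suspension X ≃ₜ Suspension Y) : Prop :=
  ∀ p : Suspension X, ∃ τ : ℝ ≃o ℝ, ∀ t : ℝ,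
    h (Suspension.flow t p) = Suspension.flow (τ t) (h p)

/-! ### Labelled graphs -/

/-- A labelled directed graph over the alphabet `A`. -/
structure LabelledGraph (A : Type u) : Type (u + 1) where
  Vertex : Type u
  Edge : Type u
  source : Edge → Vertex
  range : Edge → Vertex
  label : Edge → A

namespace LabelledGraph

variable {A : Type u}

instance (G : LabelledGraph A) : TopologicalSpace G.Edge := ⊥

instance (G : LabelledGraph A) : DiscreteTopology G.Edge := ⟨rfl⟩

/-- There is a path, possibly of length zero, from `v` to `w`. -/
def Connected (G : LabelledGraph A) (v w : G.Vertex) : Prop :=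
  Relation.ReflTransGen (fun v w => ∃ e : G.Edge, G.source e = v ∧ G.range e = w) v w

/-- The labelled subgraph induced by a set of vertices. -/
def induced (G : LabelledGraph A) (H : Set G.Vertex) : LabelledGraph A where
  Vertex := H
  Edge := {e : G.Edge // G.source e ∈ H ∧ G.range e ∈ H}
  source e := ⟨G.source e.1, e.2.1⟩
  range e := ⟨G.range e.1, e.2.2⟩
  label e := G.label e.1

/-- The edge shift: bi-infinite sequences of consecutive edges. -/
def edgeShift (G : LabelledGraph A) : Set (ℤ → G.Edge) :=
  {e | ∀ i, G.range (e i) = G.source (e (i + 1))}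

/-- The sequence of labels of a bi-infinite sequence of edges. -/
def labelSeq (G : LabelledGraph A) (e : ℤ → G.Edge) : ℤ → A := fun i => G.label (e i)

end LabelledGraph

/-! ### Predecessor sets and covers

A right-ray `x₀ x₁ x₂ ⋯` is the function `x : ℕ → A`; a left-ray `⋯ x₋₂ x₋₁` is the function
`y : ℕ → A` with `y n = x₋₍ₙ₊₁₎`. -/

/-- The bi-infinite sequence `y x` obtained by following a left-ray by a right-ray. -/
def glueRays {A : Type u} (y x : ℕ → A) : ℤ → A
  | Int.ofNat n => x n
  | Int.negSucc n => y n

/-- The ray with the letter `a` added at its finite end: `a x` for a right-ray `x`, and `y a` for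
a left-ray `y`. -/
def consRay {A : Type u} (a : A) (x : ℕ → A) : ℕ → A
  | 0 => a
  | n + 1 => x n

namespace ShiftSpace

/-- The right-rays of points of `X`. -/
def rightRays (X : ShiftSpace.{u}) : Set (ℕ → X.Alphabet) :=
  {x | ∃ z ∈ X.points, ∀ n : ℕ, x n = z n}

/-- The predecessor set of a right-ray: the left-rays that may precede it in `X`. -/
def pred (X : ShiftSpace.{u}) (x : ℕ → X.Alphabet) : Set (ℕ → X.Alphabet) :=
  {y | glueRays y x ∈ X.points}

/-- The left Krieger cover: its vertices are the predecessor sets of right-rays, and there is one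
edge labelled `a` from `P` to `P'` exactly when `P = P_∞(a x)` and `P' = P_∞(x)` for some
right-ray `x` of `X`. -/
def kriegerCover (X : ShiftSpace.{u}) : LabelledGraph X.Alphabet where
  Vertex := {P : Set (ℕ → X.Alphabet) // ∃ x ∈ X.rightRays, P = X.pred x}
  Edge := {e : {P : Set (ℕ → X.Alphabet) // ∃ x ∈ X.rightRays, P = X.pred x} × X.Alphabet ×
      {P : Set (ℕ → X.Alphabet) // ∃ x ∈ X.rightRays, P = X.pred x} //
    ∃ x ∈ X.rightRays, e.1.1 = X.pred (consRay e.2.1 x) ∧ e.2.2.1 = X.pred x}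
  source e := e.1.1
  range e := e.1.2.2
  label e := e.1.2.1

/-- A vertex of the left Krieger cover is non-decomposable if it belongs to every set of vertices
of which it is the union. -/
def NonDecomposable (X : ShiftSpace.{u}) (P : X.kriegerCover.Vertex) : Prop :=
  ∀ V : Set X.kriegerCover.Vertex, P.1 = ⋃ Q ∈ V, Q.1 → P ∈ V

/-- The generalized left Fischer cover: the subgraph of the left Krieger cover induced by the
vertices from which some non-decomposable vertex can be reached. -/
def fischerCover (X : ShiftSpace.{u}) : LabelledGraph X.Alphabet :=
  X.kriegerCover.induced {P | ∃ P', X.kriegerCover.Connected P P' ∧ X.NonDecomposable P'}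

/-! The labels of a bi-infinite path in the cover form a point of `X`. -/

theorem kriegerCover_step (X : ShiftSpace.{u}) (e : X.kriegerCover.Edge) (y : ℕ → X.Alphabet)
    (hy : y ∈ (X.kriegerCover.source e).1) :
    consRay (X.kriegerCover.label e) y ∈ (X.kriegerCover.range e).1 := by
  obtain ⟨⟨P, a, P'⟩, x, hx, h1, h2⟩ := e
  change y ∈ P.1 at hy
  change consRay a y ∈ P'.1
  simp only at h1 h2
  rw [h1] at hy
  rw [h2]
  have key : glueRays (consRay a y) x = shift 1 (glueRays y (consRay a x)) := by
    funext i
    rw [shift_apply]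
    rcases i with n | n
    · have : (1 : ℤ) + Int.ofNat n = Int.ofNat (n + 1) := by
        simp only [Int.ofNat_eq_natCast]; push_cast; ring
      rw [this]; rfl
    · rcases n with _ | n
      · rfl
      · have : (1 : ℤ) + Int.negSucc (n + 1) = Int.negSucc n := by omega
        rw [this]; rfl
  change glueRays (consRay a y) x ∈ X.points
  rw [key]
  exact X.toSubshift.mapsTo 1 hy

theorem glueRays_of_rightRay {A : Type u} (z : ℤ → A) :
    glueRays (fun n => z (Int.negSucc n)) (fun n => z n) = z := by
  funext i
  rcases i with n | n <;> rfl

theorem kriegerCover_window (X : ShiftSpace.{u}) (e : ℤ → X.kriegerCover.Edge)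
    (he : e ∈ X.kriegerCover.edgeShift) (i : ℤ) (k : ℕ) :
    ∃ y ∈ (X.kriegerCover.source (e (i + k))).1,
      ∀ j : ℕ, j < k → y j = X.kriegerCover.label (e (i + k - 1 - j)) := by
  induction k with
  | zero =>
    obtain ⟨x, ⟨z, hz, hzx⟩, hP⟩ := (X.kriegerCover.source (e (i + (0 : ℕ)))).2
    refine ⟨fun n => z (Int.negSucc n), ?_, fun j hj => absurd hj (Nat.not_lt_zero j)⟩
    rw [hP]
    change glueRays _ x ∈ X.points
    have hx : x = fun n : ℕ => z n := funext hzx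
    rw [hx, glueRays_of_rightRay]
    exact hz
  | succ k ih =>
    obtain ⟨y, hy, hyk⟩ := ih
    refine ⟨consRay (X.kriegerCover.label (e (i + k))) y, ?_, ?_⟩
    · have h := X.kriegerCover_step _ y hy
      rw [he (i + k)] at h
      have h2 : i + ((k + 1 : ℕ) : ℤ) = i + k + 1 := by push_cast; ring
      rw [h2]
      exact h
    · intro j hj
      rcases j with _ | j
      · have h2 : i + ((k + 1 : ℕ) : ℤ) - 1 - ((0 : ℕ) : ℤ) = i + k := by push_cast; ring
        rw [h2]; rfl
      · have h2 : i + ((k + 1 : ℕ) : ℤ) - 1 - ((j + 1 : ℕ) : ℤ) = i + k - 1 - j := by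
          push_cast; ring
        rw [h2]
        exact hyk j (by omega)

theorem kriegerCover_labelSeq_mem (X : ShiftSpace.{u}) (e : ℤ → X.kriegerCover.Edge)
    (he : e ∈ X.kriegerCover.edgeShift) : X.kriegerCover.labelSeq e ∈ X.points := by
  have h : ∀ N : ℕ, ∃ w ∈ X.points, ∀ m : ℤ, -(N : ℤ) ≤ m → m < N →
      w m = X.kriegerCover.labelSeq e m := by
    intro N
    obtain ⟨y, hy, hyk⟩ := X.kriegerCover_window e he (-(N : ℤ)) (2 * N)
    obtain ⟨x, -, hP⟩ := (X.kriegerCover.source (e (-(N : ℤ) + ((2 * N : ℕ) : ℤ)))).2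
    rw [hP] at hy
    refine ⟨shift (-(N : ℤ)) (glueRays y x), X.toSubshift.mapsTo _ hy, ?_⟩
    intro m hm hm'
    obtain ⟨j, hj⟩ : ∃ j : ℕ, (N : ℤ) - 1 - m = j := ⟨_, (Int.toNat_of_nonneg (by omega)).symm⟩
    have h1 : -(N : ℤ) + m = Int.negSucc j := by omega
    have h2 : -(N : ℤ) + ((2 * N : ℕ) : ℤ) - 1 - j = m := by push_cast; omega
    rw [shift_apply, h1]
    change y j = X.kriegerCover.label (e m)
    rw [hyk j (by omega), h2]
  choose w hw hwm using h
  refine X.toSubshift.isClosed.mem_of_tendsto (f := w) (b := Filter.atTop) ?_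
    (Filter.Eventually.of_forall hw)
  rw [tendsto_pi_nhds]
  intro m
  refine tendsto_const_nhds.congr' ?_
  filter_upwards [Filter.eventually_ge_atTop (m.natAbs + 1)] with N hN
  exact (hwm N m (by omega) (by omega)).symm

theorem fischerCover_labelSeq_mem (X : ShiftSpace.{u}) (e : ℤ → X.fischerCover.Edge)
    (he : e ∈ X.fischerCover.edgeShift) : X.fischerCover.labelSeq e ∈ X.points :=
  X.kriegerCover_labelSeq_mem (fun i => (e i).1) (fun i => congrArg Subtype.val (he i))

/-- The covering map of the generalized left Fischer cover, from its edge shift to `X`. -/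
def coveringMap (X : ShiftSpace.{u}) (e : X.fischerCover.edgeShift) : X.points :=
  ⟨X.fischerCover.labelSeq e.1, X.fischerCover_labelSeq_mem e.1 e.2⟩

/-- The map of suspensions induced by the covering map. -/
def coveringSuspension (X : ShiftSpace.{u}) :
    Suspension X.fischerCover.edgeShift → Suspension X.points :=
  Suspension.map X.coveringMap (by
    rintro n e e' h
    funext i
    exact congrArg X.fischerCover.label (congrFun h i))

end ShiftSpace

/-! Being flow equivalent is an equivalence relation on covering maps (`CoversFlowEquivalent`), so a
single conjugacy and a single symbol expansion have to be treated. Along a chain of such moves only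
one property is carried: finiteness of the left Krieger cover. It follows from soficity
(`IsSofic.finite_vertex`) and passes through each move in both directions (`CoverCode.finite_iff`).

Both moves give an `OrbitCode`: a continuous open injection `f` carrying orbits into orbits, meeting
every orbit of the target, with an increasing integer cocycle `k` for the change of clock.
Interpolating `k` linearly between integers turns `f` into a flow equivalence of suspensions. What
remains is to lift `f` to an orbit code `F` of the edge shifts, with cocycle `k` evaluated on labels
and with `F` lying over `f`; the square of suspensions then commutes.

A path in the cover is not determined by its labels. However, each finite window of it is the window
of an actual point `w` of `X`, read with the vertices `P_∞(w_i w_{i+1} …)` (`exists_window`), and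
coherent sequences of such points define paths (`exists_limit`). A path is thus a limit of points
for the notion of closeness `KAgree`: equal letters in a window and equal predecessor sets at its
right end. Hence `f` lifts as soon as it and its inverse are uniform for `KAgree` and preserve
membership in the Fischer cover up to a bounded displacement; this is `CoverCode`.

Membership in the Fischer cover is the delicate point, since a recoding may decompose a
non-decomposable vertex. The remedy: split a slightly later vertex of the recoded point into
non-decomposable ones, which is possible because the cover is finite, and transport the pieces back.
They cover the original vertex, so one of them equals it, and the recoded vertex therefore reaches a
non-decomposable one. This is `BlockConjugacy.inFischer_of_nonDecAt` for conjugacies and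
`ExpansionData.inFischer_of_nonDecAt_one` at an inserted symbol. -/

namespace ShiftSpace

/-! ### Gluing a past to a future -/

/-- The sequence that agrees with `v` before position `i` and with `w` from `i` on. -/
def splice {A : Type u} (i : ℤ) (v w : ℤ → A) : ℤ → A := fun j => if j < i then v j else w j

section Splice

variable {A : Type u} {i j : ℤ} {v w : ℤ → A}

theorem splice_of_lt (h : j < i) : splice i v w j = v j := if_pos h

theorem splice_of_le (h : i ≤ j) : splice i v w j = w j := if_neg (not_lt.2 h)

theorem splice_eq {u : ℤ → A} (h₁ : ∀ j < i, v j = u j) (h₂ : ∀ j, i ≤ j → w j = u j) :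
    splice i v w = u := by
  funext j
  rcases lt_or_ge j i with h | h
  · rw [splice_of_lt h, h₁ j h]
  · rw [splice_of_le h, h₂ j h]

@[simp] theorem splice_self (i : ℤ) (w : ℤ → A) : splice i w w = w :=
  splice_eq (fun _ _ => rfl) (fun _ _ => rfl)

theorem shift_splice (m i : ℤ) (v w : ℤ → A) :
    shift m (splice i v w) = splice (i - m) (shift m v) (shift m w) := by
  refine (splice_eq (fun j h => ?_) (fun j h => ?_)).symm
  · rw [shift_apply, shift_apply, splice_of_lt (by omega)]
  · rw [shift_apply, shift_apply, splice_of_le (by omega)]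

end Splice

/-! ### Predecessor sets and edges of the Krieger cover along a point -/

variable {X : ShiftSpace.{u}}

theorem shift_mem_iff (m : ℤ) {w : ℤ → X.Alphabet} : shift m w ∈ X.points ↔ w ∈ X.points := by
  refine ⟨fun h => ?_, fun h => X.toSubshift.mapsTo m h⟩
  have := X.toSubshift.mapsTo (-m) h
  rwa [← shift_add, add_neg_cancel, shift_zero] at this

variable (X) in
/-- The predecessor set of the right-ray of `w` that starts at position `i`. -/
def predAt (w : ℤ → X.Alphabet) (i : ℤ) : Set (ℕ → X.Alphabet) := X.pred fun n => w (i + n)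

/-- Trades left-rays for bi-infinite sequences, so that later arguments keep absolute positions and
speak only of `splice`. -/
theorem past_mem_predAt {v w : ℤ → X.Alphabet} {i : ℤ} :
    (fun n : ℕ => v (i - 1 - n)) ∈ X.predAt w i ↔ splice i v w ∈ X.points := by
  rw [← shift_mem_iff i]
  have : shift i (splice i v w) = glueRays (fun n : ℕ => v (i - 1 - n)) (fun n : ℕ => w (i + n)) := by
    funext j
    rw [shift_apply]
    rcases j with n | n
    · rw [splice_of_le (by simp)]; rfl
    · rw [splice_of_lt (by omega)]
      change _ = v (i - 1 - n)
      congr 1; omega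
  rw [this]; rfl

theorem exists_past (i : ℤ) (y : ℕ → X.Alphabet) (w : ℤ → X.Alphabet) :
    ∃ v : ℤ → X.Alphabet, (fun n : ℕ => v (i - 1 - n)) = y := by
  refine ⟨shift (-i) (glueRays y fun n => w n), ?_⟩
  funext n
  have : -i + (i - 1 - (n : ℤ)) = Int.negSucc n := by omega
  rw [shift_apply, this]; rfl

theorem predAt_subset_iff {w w' : ℤ → X.Alphabet} {i : ℤ} :
    X.predAt w i ⊆ X.predAt w' i ↔
      ∀ v, splice i v w ∈ X.points → splice i v w' ∈ X.points := by
  refine ⟨fun h v hv => past_mem_predAt.1 (h (past_mem_predAt.2 hv)), fun h y hy => ?_⟩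
  obtain ⟨v, rfl⟩ := exists_past i y w
  exact past_mem_predAt.2 (h v (past_mem_predAt.1 hy))

theorem splice_mem {v w : ℤ → X.Alphabet} {i : ℤ} (hv : v ∈ X.points)
    (h : X.predAt v i ⊆ X.predAt w i) : splice i v w ∈ X.points :=
  predAt_subset_iff.1 h v (by rwa [splice_self])

theorem predAt_congr {w w' : ℤ → X.Alphabet} {i : ℤ} (h : ∀ j, i ≤ j → w j = w' j) :
    X.predAt w i = X.predAt w' i := by
  unfold predAt
  congr 1
  funext n
  exact h _ (by omega)

theorem predAt_splice {v w : ℤ → X.Alphabet} {i j : ℤ} (h : i ≤ j) :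
    X.predAt (splice i v w) j = X.predAt w j :=
  predAt_congr fun l hl => splice_of_le (by omega)

theorem predAt_shift (w : ℤ → X.Alphabet) (m i : ℤ) :
    X.predAt (shift m w) i = X.predAt w (m + i) := by
  unfold predAt
  congr 1
  funext n
  rw [shift_apply, add_assoc]

/-- A past followed by the common word on `[i, j)` is a past at `j`. With equality in place of
inclusion this says that the left Krieger cover is left-resolving: range and label determine the
source. -/
theorem predAt_mono_left {w w' : ℤ → X.Alphabet} {i j : ℤ} (hij : i ≤ j)
    (h : X.predAt w j ⊆ X.predAt w' j) (hw : ∀ l, i ≤ l → l < j → w l = w' l) :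
    X.predAt w i ⊆ X.predAt w' i := by
  rw [predAt_subset_iff] at h ⊢
  intro v hv
  have h1 : splice j (splice i v w) w = splice i v w :=
    splice_eq (fun _ _ => rfl) fun l hl => (splice_of_le (by omega)).symm
  have h2 : splice j (splice i v w) w' = splice i v w' := by
    refine splice_eq (fun l hl => ?_) fun l hl => (splice_of_le (by omega)).symm
    rcases lt_or_ge l i with h | h
    · rw [splice_of_lt h, splice_of_lt h]
    · rw [splice_of_le h, splice_of_le h, hw l h hl]
  rw [← h2]
  exact h _ (by rwa [h1])

theorem predAt_eq_left {w w' : ℤ → X.Alphabet} {i j : ℤ} (hij : i ≤ j)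
    (h : X.predAt w j = X.predAt w' j) (hw : ∀ l, i ≤ l → l < j → w l = w' l) :
    X.predAt w i = X.predAt w' i :=
  (predAt_mono_left hij h.le hw).antisymm
    (predAt_mono_left hij h.ge fun l h₁ h₂ => (hw l h₁ h₂).symm)

theorem predAt_isVertex {w : ℤ → X.Alphabet} (hw : w ∈ X.points) (i : ℤ) :
    ∃ x ∈ X.rightRays, X.predAt w i = X.pred x :=
  ⟨_, ⟨shift i w, (shift_mem_iff i).2 hw, fun _ => rfl⟩, rfl⟩

/-- The vertex of the left Krieger cover at position `i` of a point. -/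
def vertexAt {w : ℤ → X.Alphabet} (hw : w ∈ X.points) (i : ℤ) : X.kriegerCover.Vertex :=
  ⟨X.predAt w i, predAt_isVertex hw i⟩

theorem pred_eq_predAt {x : ℕ → X.Alphabet} (z : ℤ → X.Alphabet) (i : ℤ)
    (h : ∀ n : ℕ, x n = z (i + n)) : X.pred x = X.predAt z i := by
  unfold predAt
  congr 1
  funext n
  exact h n

theorem exists_vertexAt (P : X.kriegerCover.Vertex) (i : ℤ) :
    ∃ z ∈ X.points, P.1 = X.predAt z i := by
  obtain ⟨x, ⟨z, hz, hx⟩, hP⟩ := P.2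
  refine ⟨shift (-i) z, (shift_mem_iff _).2 hz, hP.trans (pred_eq_predAt _ _ fun n => ?_)⟩
  rw [hx, shift_apply, neg_add_cancel_left]

/-- The edge `e` of the left Krieger cover is the one at position `i` of the point `w`. -/
def EdgeMatches (e : X.kriegerCover.Edge) (w : ℤ → X.Alphabet) (i : ℤ) : Prop :=
  (X.kriegerCover.source e).1 = X.predAt w i ∧ X.kriegerCover.label e = w i ∧
    (X.kriegerCover.range e).1 = X.predAt w (i + 1)

theorem EdgeMatches.edge_eq {e e' : X.kriegerCover.Edge} {w : ℤ → X.Alphabet} {i : ℤ}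
    (h : EdgeMatches e w i) (h' : EdgeMatches e' w i) : e = e' := by
  apply Subtype.ext
  exact Prod.ext (Subtype.ext (h.1.trans h'.1.symm))
    (Prod.ext (h.2.1.trans h'.2.1.symm) (Subtype.ext (h.2.2.trans h'.2.2.symm)))

theorem EdgeMatches.congr {e : X.kriegerCover.Edge} {w w' : ℤ → X.Alphabet} {i : ℤ}
    (h : EdgeMatches e w i) (h₁ : w i = w' i) (h₂ : X.predAt w (i + 1) = X.predAt w' (i + 1)) :
    EdgeMatches e w' i := by
  refine ⟨h.1.trans (predAt_eq_left (by omega) h₂ fun l _ _ => ?_), h.2.1.trans h₁, h.2.2.trans h₂⟩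
  obtain rfl : l = i := by omega
  exact h₁

theorem EdgeMatches.eq_and_eq {e : X.kriegerCover.Edge} {w w' : ℤ → X.Alphabet} {i : ℤ}
    (h : EdgeMatches e w i) (h' : EdgeMatches e w' i) :
    w i = w' i ∧ X.predAt w (i + 1) = X.predAt w' (i + 1) :=
  ⟨h.2.1.symm.trans h'.2.1, h.2.2.symm.trans h'.2.2⟩

theorem edgeMatches_shift {e : X.kriegerCover.Edge} {w : ℤ → X.Alphabet} {m i : ℤ} :
    EdgeMatches e (shift m w) i ↔ EdgeMatches e w (m + i) := by
  unfold EdgeMatches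
  rw [predAt_shift, predAt_shift, shift_apply, add_assoc]

theorem exists_edgeAt {w : ℤ → X.Alphabet} (hw : w ∈ X.points) (i : ℤ) :
    ∃ e : X.kriegerCover.Edge, EdgeMatches e w i := by
  refine ⟨⟨(vertexAt hw i, w i, vertexAt hw (i + 1)), fun n => w (i + 1 + n),
    ⟨shift (i + 1) w, (shift_mem_iff _).2 hw, fun _ => rfl⟩, ?_, rfl⟩, rfl, rfl, rfl⟩
  refine (pred_eq_predAt w i fun n => ?_).symm
  rcases n with _ | n
  · simp [consRay]
  · simp only [consRay]; congr 1; push_cast; ring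

theorem exists_edgeMatches (e : X.kriegerCover.Edge) (i : ℤ) :
    ∃ w ∈ X.points, EdgeMatches e w i := by
  obtain ⟨z, hz, hP⟩ := exists_vertexAt (X.kriegerCover.source e) i
  obtain ⟨⟨P, a, P'⟩, x, hx, h1, h2⟩ := e
  change P.1 = X.predAt z i at hP
  have hy : (fun n : ℕ => z (i - 1 - n)) ∈ P.1 := by
    rw [hP, past_mem_predAt, splice_self]; exact hz
  simp only at h1 h2
  have hray : ∀ n : ℕ, consRay a x n =
      shift (-i) (glueRays (fun n : ℕ => z (i - 1 - n)) (consRay a x)) (i + n) := by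
    intro n
    rw [shift_apply, neg_add_cancel_left]; rfl
  refine ⟨shift (-i) (glueRays (fun n : ℕ => z (i - 1 - n)) (consRay a x)),
    (shift_mem_iff _).2 ?_, h1.trans (pred_eq_predAt _ i hray), ?_, ?_⟩
  · rw [h1] at hy; exact hy
  · change consRay a x 0 = _
    simpa using hray 0
  · refine h2.trans (pred_eq_predAt _ _ fun n => ?_)
    have := hray (n + 1)
    change x n = _ at this
    rw [this]; congr 1; push_cast; ring

/-- The point is built leftwards, one edge at a time: at the joint the new edge and the old point
have the same predecessor set, so the past of one may precede the other, and all vertices further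
right are unchanged. The condition on the source is what remains of the statement when the window is
empty. -/
theorem exists_window {e : ℤ → X.kriegerCover.Edge} (he : e ∈ X.kriegerCover.edgeShift)
    (m : ℤ) (k : ℕ) : ∃ w ∈ X.points, (X.kriegerCover.source (e (m - k))).1 = X.predAt w (m - k) ∧
      ∀ i, m - k ≤ i → i < m → EdgeMatches (e i) w i := by
  induction k with
  | zero =>
    obtain ⟨z, hz, hP⟩ := exists_vertexAt (X.kriegerCover.source (e (m - (0 : ℕ)))) (m - (0 : ℕ))
    exact ⟨z, hz, hP, fun i h₁ h₂ => absurd h₁ (by simpa using h₂)⟩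
  | succ k ih =>
    obtain ⟨w, hw, h₁, h₂⟩ := ih
    obtain ⟨z, hz, hm⟩ := exists_edgeMatches (e (m - (k + 1 : ℕ))) (m - (k + 1 : ℕ))
    have hc := he (m - (k + 1 : ℕ))
    have hk : m - ((k + 1 : ℕ) : ℤ) + 1 = m - k := by push_cast; ring
    rw [hk] at hc
    have hp : X.predAt z (m - k) = X.predAt w (m - k) := by
      rw [← h₁, ← hc, hm.2.2, hk]
    have hm' : EdgeMatches (e (m - (k + 1 : ℕ))) (splice (m - k) z w) (m - (k + 1 : ℕ)) := by
      refine hm.congr (splice_of_lt (by push_cast; omega)).symm ?_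
      rw [hk, predAt_splice le_rfl, hp]
    refine ⟨splice (m - k) z w, splice_mem hz hp.le, hm'.1, fun i hi hi' => ?_⟩
    rcases eq_or_lt_of_le hi with rfl | h
    · exact hm'
    · push_cast at h
      exact (h₂ i (by omega) hi').congr (splice_of_le (by omega)).symm
        (predAt_splice (by omega)).symm

/-! ### Non-decomposable vertices and the Fischer cover along a point -/

variable (X) in
/-- The predecessor set at position `i` of the point `w` is a non-decomposable vertex. -/
def NonDecAt (w : ℤ → X.Alphabet) (i : ℤ) : Prop :=
  w ∈ X.points ∧ ∀ S ⊆ X.points, (∀ q ∈ S, X.predAt q i ⊆ X.predAt w i) →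
    (∀ v, splice i v w ∈ X.points → ∃ q ∈ S, splice i v q ∈ X.points) →
    ∃ q ∈ S, X.predAt q i = X.predAt w i

/-- Every vertex occurs at position `i` of some point, so families of vertices may be replaced by
families of points. -/
theorem nonDecomposable_iff {P : X.kriegerCover.Vertex} {w : ℤ → X.Alphabet} {i : ℤ}
    (hw : w ∈ X.points) (hP : P.1 = X.predAt w i) : X.NonDecomposable P ↔ X.NonDecAt w i := by
  constructor
  · intro h
    refine ⟨hw, fun S hS h₁ h₂ => ?_⟩
    obtain ⟨q, hq, hqP⟩ := h {Q | ∃ q ∈ S, Q.1 = X.predAt q i} (by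
      apply Set.Subset.antisymm
      · intro y hy
        rw [hP] at hy
        obtain ⟨v, rfl⟩ := exists_past i y w
        obtain ⟨q, hq, hv⟩ := h₂ v (past_mem_predAt.1 hy)
        exact Set.mem_biUnion (x := vertexAt (hS hq) i) ⟨q, hq, rfl⟩ (past_mem_predAt.2 hv)
      · refine Set.iUnion₂_subset ?_
        rintro Q ⟨q, hq, hQ⟩
        rw [hQ, hP]
        exact h₁ q hq)
    exact ⟨q, hq, hqP.symm.trans hP⟩
  · rintro ⟨-, h⟩ V hV
    obtain ⟨q, ⟨hq, Q, hQ, hQq⟩, hqw⟩ := h {q | q ∈ X.points ∧ ∃ Q ∈ V, Q.1 = X.predAt q i}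
      (fun q hq => hq.1) (by
        rintro q ⟨hq, Q, hQ, hQq⟩
        rw [← hP, ← hQq, hV]
        exact Set.subset_biUnion_of_mem (u := fun Q : X.kriegerCover.Vertex => Q.1) hQ) (by
        intro v hv
        have := past_mem_predAt.2 hv
        rw [← hP, hV] at this
        obtain ⟨Q, hQ, hv'⟩ := Set.mem_iUnion₂.1 this
        obtain ⟨q, hq, hQq⟩ := exists_vertexAt Q i
        exact ⟨q, ⟨hq, Q, hQ, hQq⟩, past_mem_predAt.1 (by rwa [← hQq])⟩)
    have : Q = P := Subtype.ext (by rw [hQq, hqw, hP])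
    rwa [← this]

theorem NonDecAt.congr {w w' : ℤ → X.Alphabet} {i : ℤ} (h : X.NonDecAt w i)
    (hw' : w' ∈ X.points) (he : X.predAt w i = X.predAt w' i) : X.NonDecAt w' i :=
  (nonDecomposable_iff (P := vertexAt h.1 i) hw' he).1 ((nonDecomposable_iff h.1 rfl).2 h)

theorem nonDecAt_shift {w : ℤ → X.Alphabet} {m i : ℤ} :
    X.NonDecAt (shift m w) i ↔ X.NonDecAt w (m + i) := by
  by_cases hw : w ∈ X.points
  · rw [← nonDecomposable_iff (P := vertexAt hw (m + i)) ((shift_mem_iff m).2 hw)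
      (predAt_shift w m i).symm,
      ← nonDecomposable_iff (P := vertexAt hw (m + i)) hw rfl]
  · exact ⟨fun h => absurd ((shift_mem_iff m).1 h.1) hw, fun h => absurd h.1 hw⟩

variable (X) in
/-- The vertex at position `i` of the point `w` belongs to the generalized left Fischer cover. -/
def InFischer (w : ℤ → X.Alphabet) (i : ℤ) : Prop :=
  w ∈ X.points ∧ ∃ w' ∈ X.points, ∃ j, i ≤ j ∧ X.predAt w' i = X.predAt w i ∧ X.NonDecAt w' j

theorem NonDecAt.inFischer {w : ℤ → X.Alphabet} {i : ℤ} (h : X.NonDecAt w i) :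
    X.InFischer w i := ⟨h.1, w, h.1, i, le_rfl, rfl, h⟩

theorem InFischer.congr {w w' : ℤ → X.Alphabet} {i : ℤ} (h : X.InFischer w i)
    (hw' : w' ∈ X.points) (he : X.predAt w i = X.predAt w' i) : X.InFischer w' i := by
  obtain ⟨-, z, hz, j, hij, hp, hd⟩ := h
  exact ⟨hw', z, hz, j, hij, hp.trans he, hd⟩

/-- Equal predecessor sets allow the past of the witness to be replaced by that of `w`. -/
theorem InFischer.exists_eq_left {w : ℤ → X.Alphabet} {i : ℤ} (h : X.InFischer w i) :
    ∃ w' ∈ X.points, (∀ l < i, w' l = w l) ∧ X.predAt w' i = X.predAt w i ∧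
      ∃ j, i ≤ j ∧ X.NonDecAt w' j := by
  obtain ⟨hw, z, hz, j, hij, hp, hd⟩ := h
  have hm : splice i w z ∈ X.points := splice_mem hw hp.ge
  exact ⟨splice i w z, hm, fun l hl => splice_of_lt hl, (predAt_splice le_rfl).trans hp, j, hij,
    hd.congr hm (predAt_splice hij).symm⟩

/-- The vertices of the Fischer cover are closed under predecessors, so membership throughout a
window need only be checked at its right end. -/
theorem InFischer.mono {w : ℤ → X.Alphabet} {i j : ℤ} (h : X.InFischer w j) (hij : i ≤ j) :
    X.InFischer w i := by
  obtain ⟨w', hw', h₁, h₂, l, hl, hd⟩ := h.exists_eq_left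
  exact ⟨h.1, w', hw', l, hij.trans hl, predAt_eq_left hij h₂ fun l _ hl => h₁ l hl, hd⟩

theorem inFischer_shift {w : ℤ → X.Alphabet} {m i : ℤ} :
    X.InFischer (shift m w) i ↔ X.InFischer w (m + i) := by
  constructor
  · rintro ⟨hw, z, hz, j, hij, hp, hd⟩
    refine ⟨(shift_mem_iff m).1 hw, shift (-m) z, (shift_mem_iff _).2 hz, m + j, by omega, ?_, ?_⟩
    · rw [predAt_shift, ← predAt_shift w, ← hp, neg_add_cancel_left]
    · rwa [nonDecAt_shift, neg_add_cancel_left]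
  · rintro ⟨hw, z, hz, j, hij, hp, hd⟩
    refine ⟨(shift_mem_iff m).2 hw, shift m z, (shift_mem_iff _).2 hz, j - m, by omega, ?_, ?_⟩
    · rw [predAt_shift, predAt_shift, hp]
    · rwa [nonDecAt_shift, add_sub_cancel]

theorem connected_vertexAt {w : ℤ → X.Alphabet} (hw : w ∈ X.points) {i j : ℤ} (hij : i ≤ j) :
    X.kriegerCover.Connected (vertexAt hw i) (vertexAt hw j) := by
  induction j, hij using Int.leInduction with
  | base => exact Relation.ReflTransGen.refl
  | succ j _ ih =>
    obtain ⟨e, he⟩ := exists_edgeAt hw j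
    exact ih.tail ⟨e, Subtype.ext he.1, Subtype.ext he.2.2⟩

theorem Connected.exists_point {P P' : X.kriegerCover.Vertex} (h : X.kriegerCover.Connected P P') :
    ∀ i : ℤ, ∃ w ∈ X.points, ∃ j, i ≤ j ∧ P.1 = X.predAt w i ∧ P'.1 = X.predAt w j := by
  unfold LabelledGraph.Connected at h
  induction h using Relation.ReflTransGen.head_induction_on with
  | refl =>
    intro i
    obtain ⟨z, hz, hP⟩ := exists_vertexAt P' i
    exact ⟨z, hz, i, le_rfl, hP, hP⟩
  | head hstep _ ih =>
    intro i
    obtain ⟨e, rfl, rfl⟩ := hstep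
    obtain ⟨w, hw, j, hij, h₁, h₂⟩ := ih (i + 1)
    obtain ⟨z, hz, hm⟩ := exists_edgeMatches e i
    have hp : X.predAt z (i + 1) = X.predAt w (i + 1) := hm.2.2.symm.trans h₁
    have hm' : EdgeMatches e (splice (i + 1) z w) i :=
      hm.congr (splice_of_lt (by omega)).symm (by rw [predAt_splice le_rfl, hp])
    exact ⟨splice (i + 1) z w, splice_mem hz hp.le, j, by omega, hm'.1,
      h₂.trans (predAt_splice hij).symm⟩

theorem reaches_nonDecomposable_iff {P : X.kriegerCover.Vertex} {w : ℤ → X.Alphabet} {i : ℤ}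
    (hw : w ∈ X.points) (hP : P.1 = X.predAt w i) :
    (∃ P', X.kriegerCover.Connected P P' ∧ X.NonDecomposable P') ↔ X.InFischer w i := by
  constructor
  · rintro ⟨P', hc, hn⟩
    obtain ⟨z, hz, j, hij, h₁, h₂⟩ := Connected.exists_point hc i
    exact ⟨hw, z, hz, j, hij, h₁.symm.trans hP, (nonDecomposable_iff hz h₂).1 hn⟩
  · rintro ⟨-, z, hz, j, hij, hp, hd⟩
    obtain rfl : P = vertexAt hz i := Subtype.ext (hP.trans hp.symm)
    exact ⟨_, connected_vertexAt hz hij, (nonDecomposable_iff hz rfl).2 hd⟩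

instance : PartialOrder X.kriegerCover.Vertex :=
  inferInstanceAs (PartialOrder
    {P : Set (ℕ → X.Alphabet) // ∃ x ∈ X.rightRays, P = X.pred x})

/-- In a finite left Krieger cover every vertex is the union of the non-decomposable vertices that
it contains. -/
theorem exists_nonDecAt [Finite X.kriegerCover.Vertex] {v w : ℤ → X.Alphabet} {i : ℤ}
    (hw : w ∈ X.points) (hv : splice i v w ∈ X.points) :
    ∃ q, X.NonDecAt q i ∧ X.predAt q i ⊆ X.predAt w i ∧ splice i v q ∈ X.points := by
  have key : ∀ P : X.kriegerCover.Vertex, ∀ w ∈ X.points, P.1 = X.predAt w i →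
      splice i v w ∈ X.points →
      ∃ q, X.NonDecAt q i ∧ X.predAt q i ⊆ X.predAt w i ∧ splice i v q ∈ X.points := by
    intro P
    -- A vertex that is decomposable is covered by strictly smaller ones; finiteness of the vertex
    -- set lets the descent stop.
    induction P using WellFoundedLT.induction with
    | ind P ih =>
      intro w hw hP hv
      by_cases hd : X.NonDecAt w i
      · exact ⟨w, hd, subset_rfl, hv⟩
      · have : ¬ ∀ S ⊆ X.points, (∀ q ∈ S, X.predAt q i ⊆ X.predAt w i) →
          (∀ v, splice i v w ∈ X.points → ∃ q ∈ S, splice i v q ∈ X.points) →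
          ∃ q ∈ S, X.predAt q i = X.predAt w i := fun h => hd ⟨hw, h⟩
        push Not at this
        obtain ⟨S, hS, h₁, h₂, h₃⟩ := this
        obtain ⟨q, hq, hvq⟩ := h₂ v hv
        have hlt : vertexAt (hS hq) i < P := by
          change X.predAt q i < P.1
          rw [hP]
          exact (h₁ q hq).lt_of_ne (h₃ q hq)
        obtain ⟨q', hq', hs, hvq'⟩ := ih _ hlt q (hS hq) rfl hvq
        exact ⟨q', hq', hs.trans (h₁ q hq), hvq'⟩
  exact key (vertexAt hw i) w hw rfl hv

end ShiftSpace

/-! ### Orbit codes and the flow equivalences that they induce -/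

section TimeChange

/-- The piecewise linear interpolation of a function on the integers. -/
noncomputable def interpolate (κ : ℤ → ℤ) (t : ℝ) : ℝ :=
  κ ⌊t⌋ + Int.fract t * (κ (⌊t⌋ + 1) - κ ⌊t⌋)

variable {κ : ℤ → ℤ}

theorem le_interpolate (h : ∀ n, κ n < κ (n + 1)) (t : ℝ) : (κ ⌊t⌋ : ℝ) ≤ interpolate κ t := by
  have h1 : (κ ⌊t⌋ : ℝ) < κ (⌊t⌋ + 1) := by exact_mod_cast h _
  have := mul_nonneg (Int.fract_nonneg t) (sub_nonneg.2 h1.le)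
  unfold interpolate
  linarith

theorem interpolate_lt (h : ∀ n, κ n < κ (n + 1)) (t : ℝ) :
    interpolate κ t < κ (⌊t⌋ + 1) := by
  have h1 : (κ ⌊t⌋ : ℝ) < κ (⌊t⌋ + 1) := by exact_mod_cast h _
  have := mul_lt_mul_of_pos_right (Int.fract_lt_one t) (sub_pos.2 h1)
  unfold interpolate
  linarith

theorem strictMono_interpolate (h : ∀ n, κ n < κ (n + 1)) : StrictMono (interpolate κ) := by
  intro s t hst
  rcases eq_or_lt_of_le (Int.floor_mono hst.le) with he | hlt
  · have h1 : (κ ⌊t⌋ : ℝ) < κ (⌊t⌋ + 1) := by exact_mod_cast h _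
    have h2 : Int.fract s < Int.fract t := by
      unfold Int.fract; rw [he]; linarith
    have := mul_lt_mul_of_pos_right h2 (sub_pos.2 h1)
    unfold interpolate
    rw [he]
    linarith
  · have h1 : κ (⌊s⌋ + 1) ≤ κ ⌊t⌋ := (strictMono_int_of_lt_succ h).monotone hlt
    calc interpolate κ s < κ (⌊s⌋ + 1) := interpolate_lt h s
      _ ≤ κ ⌊t⌋ := by exact_mod_cast h1
      _ ≤ interpolate κ t := le_interpolate h t

theorem le_apply_of_lt_succ (h : ∀ n, κ n < κ (n + 1)) (n : ℕ) : κ 0 + n ≤ κ n := by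
  induction n with
  | zero => simp
  | succ n ih => have := h n; push_cast; omega

theorem apply_neg_le_of_lt_succ (h : ∀ n, κ n < κ (n + 1)) (n : ℕ) : κ (-n) ≤ κ 0 - n := by
  induction n with
  | zero => simp
  | succ n ih =>
    have := h (-((n + 1 : ℕ) : ℤ))
    rw [show -((n + 1 : ℕ) : ℤ) + 1 = -n by push_cast; ring] at this
    push_cast at *; omega

theorem exists_le_lt_succ (h : ∀ n, κ n < κ (n + 1)) (p : ℤ) :
    ∃ n, κ n ≤ p ∧ p < κ (n + 1) := by
  have hm := strictMono_int_of_lt_succ h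
  obtain ⟨n, hn, hmax⟩ := Int.exists_greatest_of_bdd (P := fun n => κ n ≤ p)
    ⟨(p - κ 0).natAbs, fun z hz => by
      by_contra! hlt
      have h1 := hm hlt
      have h2 := le_apply_of_lt_succ h (p - κ 0).natAbs
      omega⟩
    ⟨-((κ 0 - p).natAbs : ℤ), by
      have := apply_neg_le_of_lt_succ h (κ 0 - p).natAbs
      omega⟩
  refine ⟨n, hn, ?_⟩
  by_contra! hlt
  have := hmax _ hlt
  omega

theorem surjective_interpolate (h : ∀ n, κ n < κ (n + 1)) :
    Function.Surjective (interpolate κ) := by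
  intro s
  obtain ⟨n, h1, h2⟩ := exists_le_lt_succ h ⌊s⌋
  have h1' : (κ n : ℝ) ≤ s := Int.le_floor.1 h1
  have h2' : s < κ (n + 1) := Int.floor_lt.1 h2
  have hpos : (0 : ℝ) < κ (n + 1) - κ n := by linarith
  set r := (s - κ n) / (κ (n + 1) - κ n) with hr
  have hr0 : 0 ≤ r := div_nonneg (by linarith) hpos.le
  have hr1 : r < 1 := (div_lt_one hpos).2 (by linarith)
  have hfl : ⌊(n : ℝ) + r⌋ = n := by
    rw [Int.floor_eq_iff]; constructor <;> linarith
  refine ⟨n + r, ?_⟩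
  unfold interpolate Int.fract
  rw [hfl, add_sub_cancel_left, hr, div_mul_cancel₀ _ hpos.ne']
  ring

/-- The interpolation of a strictly increasing function, as an order isomorphism. -/
noncomputable def interpolateIso (h : ∀ n, κ n < κ (n + 1)) : ℝ ≃o ℝ :=
  (strictMono_interpolate h).orderIsoOfSurjective _ (surjective_interpolate h)

/-- The cocycle identity is what makes the time change compatible with `(x, t) ∼ (σⁿ x, t - n)`. -/
theorem interpolate_sub_int {κ' : ℤ → ℤ} {n : ℤ} (h : ∀ m, κ' m = κ (n + m) - κ n) (t : ℝ) :
    interpolate κ' (t - n) = interpolate κ t - κ n := by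
  unfold interpolate
  rw [Int.floor_sub_intCast, Int.fract_sub_intCast, h, h,
    show n + (⌊t⌋ - n) = ⌊t⌋ by ring, show n + (⌊t⌋ - n + 1) = ⌊t⌋ + 1 by ring]
  push_cast
  ring

theorem interpolate_congr {κ' : ℤ → ℤ} {N : ℕ} (h : ∀ n : ℤ, n.natAbs ≤ N → κ n = κ' n) {t : ℝ}
    (ht : |t| < N - 1) : interpolate κ t = interpolate κ' t := by
  obtain ⟨h1, h2⟩ := abs_lt.1 ht
  have h3 : -(N : ℤ) ≤ ⌊t⌋ := Int.le_floor.2 (by push_cast; linarith)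
  have h4 : ⌊t⌋ < (N : ℤ) - 1 := Int.floor_lt.2 (by push_cast; linarith)
  unfold interpolate
  rw [h ⌊t⌋ (by omega), h (⌊t⌋ + 1) (by omega)]

end TimeChange

/-! ### The suspension as a quotient by an action of the integers -/

section Suspension

variable {A : Type u} {X : Set (ℤ → A)}

theorem Suspension.mk_eq_mk {x x' : X} {t t' : ℝ} :
    Suspension.mk x t = Suspension.mk x' t' ↔
      ∃ n : ℤ, (x' : ℤ → A) = shift n (x : ℤ → A) ∧ t' = t - n :=
  Quotient.eq (r := suspensionSetoid X)

theorem Suspension.exists_rep (p : Suspension X) : ∃ x t, p = Suspension.mk x t := by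
  induction p using Quotient.inductionOn with
  | h a => exact ⟨a.1, a.2, rfl⟩

/-- The saturation of an open set is the union of its preimages under the continuous maps `(x, t) ↦
(σⁿ x, t - n)`. -/
theorem Suspension.isOpenMap_mk [TopologicalSpace A] (hX : ∀ n : ℤ, ∀ x ∈ X, shift n x ∈ X) :
    IsOpenMap fun p : X × ℝ => Suspension.mk p.1 p.2 := by
  intro U hU
  change IsOpen ((fun p : X × ℝ => Suspension.mk p.1 p.2) ⁻¹' _)
  have : (fun p : X × ℝ => Suspension.mk p.1 p.2) ⁻¹'
      ((fun p : X × ℝ => Suspension.mk p.1 p.2) '' U) =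
      ⋃ n : ℤ, (fun p : X × ℝ => ((⟨shift n p.1.1, hX n _ p.1.2⟩ : X), p.2 - n)) ⁻¹' U := by
    ext ⟨x, t⟩
    simp only [Set.mem_preimage, Set.mem_iUnion]
    constructor
    · rintro ⟨⟨x', t'⟩, hU', he⟩
      obtain ⟨n, h1, h2⟩ := Suspension.mk_eq_mk.1 (he.symm : Suspension.mk x t = Suspension.mk x' t')
      refine ⟨n, ?_⟩
      convert hU' using 1
      exact Prod.ext (Subtype.ext h1.symm) h2.symm
    · rintro ⟨n, hn⟩
      exact ⟨_, hn, (Suspension.mk_eq_mk.2 ⟨n, rfl, rfl⟩ : Suspension.mk x t = _).symm⟩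
  rw [this]
  refine isOpen_iUnion fun n => hU.preimage ?_
  refine Continuous.prodMk (Continuous.subtype_mk ?_ _) (by fun_prop)
  exact (continuous_shift n).comp (by fun_prop)

end Suspension

section OrbitCode

open Topology

variable {A B : Type u} [TopologicalSpace A] [TopologicalSpace B] {X : Set (ℤ → A)}
  {Y : Set (ℤ → B)}

/-- A continuous open map `f` that maps orbits injectively onto orbits, where the increasing cocycle
`k` tells how many steps in `Y` correspond to `n` steps in `X`. -/
structure OrbitCode (f : X → Y) (k : X → ℤ → ℤ) : Prop where
  continuous : Continuous f
  isOpenMap : IsOpenMap f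
  k_zero : ∀ x, k x 0 = 0
  k_lt : ∀ x n, k x n < k x (n + 1)
  map_shift : ∀ {n : ℤ} {x x' : X}, (x' : ℤ → A) = shift n (x : ℤ → A) →
    (f x' : ℤ → B) = shift (k x n) (f x : ℤ → B)
  k_shift : ∀ {n : ℤ} {x x' : X}, (x' : ℤ → A) = shift n (x : ℤ → A) →
    ∀ m, k x' m = k x (n + m) - k x n
  eventually_k : ∀ x n, ∀ᶠ x' in 𝓝 x, k x' n = k x n
  exists_shift : ∀ y : Y, ∃ (x : X) (m : ℤ), (y : ℤ → B) = shift m (f x : ℤ → B)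
  of_shift : ∀ {x x' : X} {m : ℤ}, (f x' : ℤ → B) = shift m (f x : ℤ → B) →
    ∃ n, k x n = m ∧ (x' : ℤ → A) = shift n (x : ℤ → A)

namespace OrbitCode

variable {f : X → Y} {k : X → ℤ → ℤ}

theorem injective (h : OrbitCode f k) : Function.Injective f := by
  intro x x' he
  obtain ⟨n, hn, hx⟩ := h.of_shift (x := x) (x' := x') (m := 0) (by rw [he]; simp)
  have : n = 0 := (strictMono_int_of_lt_succ (h.k_lt x)).injective (hn.trans (h.k_zero x).symm)
  subst this
  exact Subtype.ext (by rw [hx]; simp)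

/-- The map of suspensions induced by an orbit code. -/
noncomputable def susp (h : OrbitCode f k) : Suspension X → Suspension Y :=
  Quotient.map (sa := suspensionSetoid X) (sb := suspensionSetoid Y)
    (fun p : X × ℝ => (f p.1, interpolate (k p.1) p.2)) (by
      rintro p q ⟨n, h₁, h₂⟩
      refine ⟨k p.1 n, h.map_shift h₁, ?_⟩
      simp only [h₂]
      exact interpolate_sub_int (h.k_shift h₁) _)

theorem susp_mk (h : OrbitCode f k) (x : X) (t : ℝ) :
    h.susp (Suspension.mk x t) = Suspension.mk (f x) (interpolate (k x) t) := rfl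

theorem susp_bijective (h : OrbitCode f k) : Function.Bijective h.susp := by
  constructor
  · intro p q hpq
    obtain ⟨x, t, rfl⟩ := p.exists_rep
    obtain ⟨x', t', rfl⟩ := q.exists_rep
    rw [h.susp_mk, h.susp_mk, Suspension.mk_eq_mk] at hpq
    obtain ⟨m, h₁, h₂⟩ := hpq
    obtain ⟨n, rfl, hx⟩ := h.of_shift h₁
    refine Suspension.mk_eq_mk.2 ⟨n, hx, ?_⟩
    rw [← interpolate_sub_int (h.k_shift hx)] at h₂
    exact (strictMono_interpolate (h.k_lt x')).injective h₂
  · intro q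
    obtain ⟨y, s, rfl⟩ := q.exists_rep
    obtain ⟨x, m, hy⟩ := h.exists_shift y
    obtain ⟨t, ht⟩ := surjective_interpolate (h.k_lt x) (s + m)
    refine ⟨Suspension.mk x t, ?_⟩
    rw [h.susp_mk, ht, Suspension.mk_eq_mk]
    exact ⟨m, hy, by ring⟩

/-- The cocycle is locally constant and a bounded time sees only finitely many of its values, so
locally the map is the product of `f` with one fixed homeomorphism of the line. Continuity and
openness both follow from this. -/
theorem eventuallyEq (h : OrbitCode f k) (p : X × ℝ) :
    (fun q : X × ℝ => (f q.1, interpolate (k q.1) q.2)) =ᶠ[𝓝 p]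
      Prod.map f (interpolateIso (h.k_lt p.1)) := by
  obtain ⟨x, t⟩ := p
  obtain ⟨N, hN⟩ := exists_nat_gt (|t| + 1)
  have h1 : ∀ᶠ x' in 𝓝 x, ∀ n ∈ Finset.Icc (-(N : ℤ)) N, k x' n = k x n :=
    (Filter.eventually_all_finset _).2 fun n _ => h.eventually_k x n
  have h2 : ∀ᶠ t' in 𝓝 t, |t'| < (N : ℝ) - 1 :=
    (continuous_abs.tendsto t).eventually (gt_mem_nhds (by linarith))
  rw [nhds_prod_eq]
  filter_upwards [h1.prod_mk h2] with q hq
  refine Prod.ext rfl (interpolate_congr (N := N) (fun n hn => hq.1 n ?_) hq.2)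
  rw [Finset.mem_Icc]
  omega

theorem susp_continuous (h : OrbitCode f k) : Continuous h.susp := by
  have hc : Continuous fun q : X × ℝ => (f q.1, interpolate (k q.1) q.2) := by
    rw [continuous_iff_continuousAt]
    intro p
    exact ((h.continuous.prodMap (interpolateIso _).continuous).continuousAt).congr
      (h.eventuallyEq p).symm
  exact Continuous.quotient_map' hc _

theorem susp_isOpenMap (h : OrbitCode f k) (hY : ∀ n : ℤ, ∀ y ∈ Y, shift n y ∈ Y) :
    IsOpenMap h.susp := by
  have hc : IsOpenMap fun q : X × ℝ => (f q.1, interpolate (k q.1) q.2) := by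
    rw [isOpenMap_iff_nhds_le]
    intro p
    rw [Filter.map_congr (h.eventuallyEq p), (h.eventuallyEq p).eq_of_nhds]
    exact (h.isOpenMap.prodMap (interpolateIso (h.k_lt p.1)).toHomeomorph.isOpenMap).nhds_le p
  intro U hU
  have hs : h.susp '' U = (fun p : Y × ℝ => Suspension.mk p.1 p.2) ''
      ((fun q : X × ℝ => (f q.1, interpolate (k q.1) q.2)) ''
        ((fun p : X × ℝ => Suspension.mk p.1 p.2) ⁻¹' U)) := by
    ext q
    constructor
    · rintro ⟨p, hp, rfl⟩
      obtain ⟨x, t, rfl⟩ := p.exists_rep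
      exact ⟨_, ⟨(x, t), hp, rfl⟩, rfl⟩
    · rintro ⟨_, ⟨⟨x, t⟩, hp, rfl⟩, rfl⟩
      exact ⟨_, hp, rfl⟩
  rw [hs]
  refine Suspension.isOpenMap_mk hY _ (hc _ (hU.preimage ?_))
  exact continuous_quotient_mk'

/-- The homeomorphism of suspensions induced by an orbit code. -/
noncomputable def suspHomeomorph (h : OrbitCode f k) (hY : ∀ n : ℤ, ∀ y ∈ Y, shift n y ∈ Y) :
    Suspension X ≃ₜ Suspension Y :=
  (Equiv.ofBijective _ h.susp_bijective).toHomeomorphOfContinuousOpen h.susp_continuous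
    (h.susp_isOpenMap hY)

theorem suspHomeomorph_mk (h : OrbitCode f k) (hY : ∀ n : ℤ, ∀ y ∈ Y, shift n y ∈ Y) (x : X)
    (t : ℝ) : h.suspHomeomorph hY (Suspension.mk x t) =
      Suspension.mk (f x) (interpolate (k x) t) := rfl

theorem isFlowEquivalence (h : OrbitCode f k) (hY : ∀ n : ℤ, ∀ y ∈ Y, shift n y ∈ Y) :
    IsFlowEquivalence (h.suspHomeomorph hY) := by
  intro p
  obtain ⟨x, s, rfl⟩ := p.exists_rep
  -- The time change along the line of `(x, s)` is the interpolated clock, normalised to vanish at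
  -- `s`.
  refine ⟨((OrderIso.addLeft s).trans (interpolateIso (h.k_lt x))).trans
    (OrderIso.addRight (-interpolate (k x) s)), fun t => ?_⟩
  change h.suspHomeomorph hY (Suspension.mk x (s + t)) = Suspension.mk (f x)
    (interpolate (k x) s + (interpolate (k x) (s + t) + -interpolate (k x) s))
  rw [suspHomeomorph_mk]
  congr 1
  ring

end OrbitCode

end OrbitCode

/-! ### Flow equivalences compose and invert -/

section FlowEquivalence

variable {A B C : Type u} [TopologicalSpace A] [TopologicalSpace B] [TopologicalSpace C]
  {X : Set (ℤ → A)} {Y : Set (ℤ → B)} {Z : Set (ℤ → C)}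

theorem IsFlowEquivalence.refl : IsFlowEquivalence (Homeomorph.refl (Suspension X)) :=
  fun _ => ⟨OrderIso.refl ℝ, fun _ => rfl⟩

theorem IsFlowEquivalence.symm {h : Suspension X ≃ₜ Suspension Y} (hh : IsFlowEquivalence h) :
    IsFlowEquivalence h.symm := by
  intro q
  obtain ⟨τ, hτ⟩ := hh (h.symm q)
  refine ⟨τ.symm, fun t => ?_⟩
  rw [h.symm_apply_eq, hτ, τ.apply_symm_apply, h.apply_symm_apply]

theorem IsFlowEquivalence.trans {h : Suspension X ≃ₜ Suspension Y}
    {g : Suspension Y ≃ₜ Suspension Z} (hh : IsFlowEquivalence h) (hg : IsFlowEquivalence g) :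
    IsFlowEquivalence (h.trans g) := by
  intro p
  obtain ⟨τ, hτ⟩ := hh p
  obtain ⟨ρ, hρ⟩ := hg (h p)
  refine ⟨τ.trans ρ, fun t => ?_⟩
  rw [Homeomorph.trans_apply, hτ, hρ]
  rfl

end FlowEquivalence

open Topology in
/-- Neighbourhoods in a space of bi-infinite sequences over a discrete alphabet. -/
theorem mem_nhds_iff_window {A : Type u} [TopologicalSpace A] [DiscreteTopology A]
    {S : Set (ℤ → A)} {x : S} {U : Set S} :
    U ∈ 𝓝 x ↔ ∃ N : ℕ, ∀ y : S, (∀ i : ℤ, i.natAbs ≤ N → (y : ℤ → A) i = (x : ℤ → A) i) → y ∈ U := by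
  rw [nhds_subtype_eq_comap, Filter.mem_comap]
  constructor
  · rintro ⟨t, ht, htU⟩
    rw [nhds_pi, Filter.mem_pi] at ht
    obtain ⟨I, hI, s, hs, hst⟩ := ht
    obtain ⟨N, hN⟩ := (hI.image Int.natAbs).bddAbove
    refine ⟨N, fun y hy => htU (hst fun i hi => ?_)⟩
    rw [hy i (hN ⟨i, hi, rfl⟩)]
    exact mem_of_mem_nhds (hs i)
  · rintro ⟨N, hN⟩
    refine ⟨(Set.Icc (-(N : ℤ)) N).pi fun i => {(x : ℤ → A) i}, ?_, fun y hy => ?_⟩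
    · exact set_pi_mem_nhds (Set.finite_Icc _ _) fun i _ => by simp [nhds_discrete]
    · exact hN y fun i hi => hy i (Set.mem_Icc.2 (by omega))

namespace LabelledGraph

variable {A : Type u} {G : LabelledGraph A}

theorem shift_mem_edgeShift (n : ℤ) : ∀ e ∈ G.edgeShift, shift n e ∈ G.edgeShift := by
  intro e he i
  rw [shift_apply, shift_apply, he (n + i), add_assoc]

theorem isClosed_edgeShift : IsClosed G.edgeShift := by
  have : G.edgeShift = ⋂ i : ℤ, {e | G.range (e i) = G.source (e (i + 1))} := by
    ext e; simp [edgeShift]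
  rw [this]
  refine isClosed_iInter fun i => ?_
  have hc : Continuous fun e : ℤ → G.Edge => (e i, e (i + 1)) := by fun_prop
  exact (isClosed_discrete {p : G.Edge × G.Edge | G.range p.1 = G.source p.2}).preimage hc

end LabelledGraph

namespace ShiftSpace

variable {X Y : ShiftSpace.{u}}

theorem shift_mem_points (X : ShiftSpace.{u}) (n : ℤ) : ∀ x ∈ X.points, shift n x ∈ X.points :=
  fun _ hx => (shift_mem_iff n).2 hx

instance : CompactSpace X.points := isCompact_iff_compactSpace.1 X.toSubshift.isClosed.isCompact

instance [Finite X.kriegerCover.Vertex] : Finite X.kriegerCover.Edge :=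
  have : Finite {P : Set (ℕ → X.Alphabet) // ∃ x ∈ X.rightRays, P = X.pred x} :=
    inferInstanceAs (Finite X.kriegerCover.Vertex)
  Subtype.finite

instance [Finite X.kriegerCover.Vertex] : Finite X.fischerCover.Edge :=
  inferInstanceAs (Finite {_e : X.kriegerCover.Edge // _})

instance [Finite X.kriegerCover.Vertex] : CompactSpace X.fischerCover.edgeShift :=
  isCompact_iff_compactSpace.1 LabelledGraph.isClosed_edgeShift.isCompact

/-! ### Paths in the covers as limits of points -/

variable (X) in
/-- The points `w` and `w'` have the same edges of the left Krieger cover in the window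
`[-N, N]`. -/
def KAgree (N : ℕ) (w w' : ℤ → X.Alphabet) : Prop :=
  (∀ i : ℤ, i.natAbs ≤ N → w i = w' i) ∧ X.predAt w (N + 1) = X.predAt w' (N + 1)

variable (X) in
/-- The path `e` in the generalized left Fischer cover and the point `w` have the same edges in the
window `[-N, N]`. -/
def Agree (N : ℕ) (e : ℤ → X.fischerCover.Edge) (w : ℤ → X.Alphabet) : Prop :=
  ∀ i : ℤ, i.natAbs ≤ N → EdgeMatches (e i).1 w i

section Agree

variable {N M : ℕ} {w w' w'' : ℤ → X.Alphabet} {e e' : ℤ → X.fischerCover.Edge}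

theorem KAgree.trans (h : X.KAgree N w w') (h' : X.KAgree N w' w'') : X.KAgree N w w'' :=
  ⟨fun i hi => (h.1 i hi).trans (h'.1 i hi), h.2.trans h'.2⟩

/-- The vertices inside the window are computed backwards from the one at its right end. -/
theorem KAgree.mono (h : X.KAgree M w w') (hNM : N ≤ M) : X.KAgree N w w' :=
  ⟨fun i hi => h.1 i (hi.trans hNM),
    predAt_eq_left (by omega) h.2 fun l _ _ => h.1 l (by omega)⟩

theorem Agree.mono (h : X.Agree M e w) (hNM : N ≤ M) : X.Agree N e w :=
  fun i hi => h i (hi.trans hNM)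

theorem Agree.kAgree (h : X.Agree N e w) (h' : X.Agree N e w') : X.KAgree N w w' :=
  ⟨fun i hi => ((h i hi).eq_and_eq (h' i hi)).1, ((h N (by simp)).eq_and_eq (h' N (by simp))).2⟩

theorem Agree.congr (h : X.Agree N e w) (h' : X.KAgree N w w') : X.Agree N e w' := by
  intro i hi
  exact (h i hi).congr (h'.1 i hi)
    (predAt_eq_left (by omega) h'.2 fun l _ _ => h'.1 l (by omega))

theorem Agree.congr_left (h : X.Agree N e w) (h' : ∀ i : ℤ, i.natAbs ≤ N → e' i = e i) :
    X.Agree N e' w := fun i hi => by rw [h' i hi]; exact h i hi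

theorem Agree.label_eq (h : X.Agree N e w) {i : ℤ} (hi : i.natAbs ≤ N) :
    X.fischerCover.labelSeq e i = w i := (h i hi).2.1

theorem Agree.eq_at (h : X.Agree N e w) (h' : X.Agree N e' w) {i : ℤ} (hi : i.natAbs ≤ N) :
    e i = e' i := Subtype.ext ((h i hi).edge_eq (h' i hi))

theorem Agree.ext (h : ∀ N, ∃ w, X.Agree N e w ∧ X.Agree N e' w) : e = e' := by
  funext i
  obtain ⟨w, h₁, h₂⟩ := h i.natAbs
  exact h₁.eq_at h₂ le_rfl

theorem Agree.shift {m : ℤ} (h : X.Agree M e w) (hM : N + m.natAbs ≤ M) :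
    X.Agree N (shift m e) (shift m w) := fun i hi => by
  rw [edgeMatches_shift, shift_apply]
  exact h _ (by omega)

theorem Agree.inFischer (h : X.Agree N e w) (hw : w ∈ X.points) : X.InFischer w (N + 1) :=
  (reaches_nonDecomposable_iff hw (h N (by simp)).2.2).1 (e N).2.2

theorem exists_agree (he : e ∈ X.fischerCover.edgeShift) (N : ℕ) :
    ∃ w ∈ X.points, X.Agree N e w := by
  -- The window `[-N, N]` consists of the `2 * N + 1` edges that end at position `N + 1`.
  obtain ⟨w, hw, -, h⟩ := exists_window (e := fun i => (e i).1)
    (fun i => congrArg Subtype.val (he i)) (N + 1) (2 * N + 1)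
  exact ⟨w, hw, fun i hi => h i (by push_cast; omega) (by omega)⟩

/-- The converse of `exists_agree`. The letters alone converge to a point, but predecessor sets need
not depend continuously on the point, so the path records more than that limit. The edge at `i` is
read from `w |i|`. -/
theorem exists_limit (w : ℕ → ℤ → X.Alphabet) (hw : ∀ N, w N ∈ X.points)
    (hK : ∀ N, X.KAgree N (w N) (w (N + 1))) (hF : ∀ N : ℕ, X.InFischer (w N) (N + 1)) :
    ∃ e ∈ X.fischerCover.edgeShift, ∀ N, X.Agree N e (w N) := by
  have hK' : ∀ N M, N ≤ M → X.KAgree N (w N) (w M) := by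
    intro N M hNM
    induction M, hNM using Nat.le_induction with
    | base => exact ⟨fun _ _ => rfl, rfl⟩
    | succ M hNM ih => exact ih.trans ((hK M).mono hNM)
  have hex : ∀ i : ℤ, ∃ e : X.fischerCover.Edge, EdgeMatches e.1 (w i.natAbs) i := by
    intro i
    obtain ⟨e, he⟩ := exists_edgeAt (hw i.natAbs) i
    exact ⟨⟨e, (reaches_nonDecomposable_iff (hw _) he.1).2 ((hF _).mono (by omega)),
      (reaches_nonDecomposable_iff (hw _) he.2.2).2 ((hF _).mono (by omega))⟩, he⟩
  choose e he using hex
  have hA : ∀ N, X.Agree N e (w N) := by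
    intro N i hi
    have hk := hK' _ _ hi
    exact (he i).congr (hk.1 i le_rfl)
      (predAt_eq_left (by omega) hk.2 fun l _ _ => hk.1 l (by omega))
  refine ⟨e, fun i => Subtype.ext (Subtype.ext ?_), hA⟩
  exact (hA (i.natAbs + 1) i (by omega)).2.2.trans (hA (i.natAbs + 1) (i + 1) (by omega)).1.symm

/-- Transfer of a path along two families of points, when agreement in the first family implies
agreement in the second. -/
theorem exists_transfer {T : Type u} (p : T → X.points) (q : T → Y.points) (M : ℕ → ℕ)
    (hK : ∀ N t t', X.KAgree (M N) (p t) (p t') → Y.KAgree N (q t) (q t'))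
    (hF : ∀ (N : ℕ) t, X.InFischer (p t) (M N + 1) → Y.InFischer (q t) (N + 1))
    (he : ∀ N, ∃ t, X.Agree N e (p t)) :
    ∃ e' ∈ Y.fischerCover.edgeShift, ∀ N t, X.Agree (M N) e (p t) → Y.Agree N e' (q t) := by
  -- `M` need not be monotone; the maximum makes the samples for `N` and `N + 1` both agree with `e`
  -- up to `M (N + 1)`, hence comparable.
  choose t ht using fun N => he (max (M N) (M (N + 1)))
  obtain ⟨e', he', hA⟩ := exists_limit (fun N => (q (t N) : ℤ → Y.Alphabet)) (fun N => (q (t N)).2)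
    (fun N => (hK (N + 1) _ _ (((ht N).mono (le_max_right _ _)).kAgree
      ((ht (N + 1)).mono (le_max_left _ _)))).mono (Nat.le_succ N))
    (fun N => hF N _ (((ht N).mono (le_max_left _ _)).inFischer (p _).2))
  exact ⟨e', he', fun N s hs =>
    (hA N).congr (hK N _ _ (((ht N).mono (le_max_left _ _)).kAgree hs))⟩

end Agree

/-! ### Lifting orbit codes to the covers -/

/-- An orbit code between shift spaces that respects the left Krieger covers and, if these are
finite, the generalized left Fischer covers. -/
structure CoverCode (f : X.points → Y.points) (k : X.points → ℤ → ℤ) : Prop where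
  orbitCode : OrbitCode f k
  exists_shift : ∀ y : Y.points, ∃ (x : X.points) (m : ℤ), (m = 0 ∨ m = 1) ∧
    (y : ℤ → Y.Alphabet) = shift m (f x : ℤ → Y.Alphabet)
  forth : ∀ N : ℕ, ∃ M : ℕ, ∀ w w' : X.points, X.KAgree M w w' → Y.KAgree N (f w) (f w')
  back : ∀ N : ℕ, ∃ M : ℕ, ∀ w w' : X.points, Y.KAgree M (f w) (f w') → X.KAgree N w w'
  forthFischer : Finite Y.kriegerCover.Vertex → ∀ N : ℕ, ∃ M : ℕ, ∀ w : X.points,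
    X.InFischer w (M + 1) → Y.InFischer (f w) (N + 1)
  backFischer : Finite X.kriegerCover.Vertex → ∀ N : ℕ, ∃ M : ℕ, ∀ w : X.points,
    Y.InFischer (f w) (M + 1) → X.InFischer w (N + 1)

theorem finite_of_determined {α β γ : Type*} [Finite β] {V : α → γ} {D : α → β}
    (hV : Function.Surjective V) (hDV : ∀ s s', D s = D s' → V s = V s') : Finite γ := by
  refine Finite.of_surjective (fun d : Set.range D => V d.2.choose) fun P => ?_
  obtain ⟨s, rfl⟩ := hV P
  exact ⟨⟨D s, s, rfl⟩, hDV _ _ (Exists.choose_spec (⟨s, rfl⟩ : ∃ y, D y = D s))⟩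

/-- Each vertex of `Y` occurs at position `0` or `1` of some `q t`, inside the window of radius `1`.
It is then determined by finitely much data of `p t`: the letters in `[-M, M]` and the vertex at `M
+ 1`. -/
theorem finite_vertex_of_determined {T : Type u} (p : T → X.points) (q : T → Y.points) (M : ℕ)
    (hK : ∀ t t', X.KAgree M (p t) (p t') → Y.KAgree 1 (q t) (q t'))
    (hq : ∀ y : Y.points, ∃ (t : T) (m : ℤ), (m = 0 ∨ m = 1) ∧
      (y : ℤ → Y.Alphabet) = shift m (q t : ℤ → Y.Alphabet))
    [Finite X.kriegerCover.Vertex] : Finite Y.kriegerCover.Vertex := by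
  let D : T × Bool → (X.kriegerCover.Vertex × (Set.Icc (-(M : ℤ)) M → X.Alphabet)) × Bool :=
    fun s => ((vertexAt (p s.1).2 (M + 1), fun i => (p s.1 : ℤ → X.Alphabet) i), s.2)
  let V : T × Bool → Y.kriegerCover.Vertex :=
    fun s => vertexAt (q s.1).2 (if s.2 then 1 else 0)
  have hDV : ∀ s s', D s = D s' → V s = V s' := by
    rintro ⟨t, b⟩ ⟨t', b'⟩ h
    simp only [D, Prod.mk.injEq] at h
    obtain ⟨⟨h1, h2⟩, rfl⟩ := h
    have hk := hK t t' ⟨fun i hi => congrFun h2 ⟨i, by rw [Set.mem_Icc]; omega⟩,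
      congrArg Subtype.val h1⟩
    refine Subtype.ext (predAt_eq_left (j := (1 : ℕ) + 1) (by split_ifs <;> simp) hk.2
      fun l hl hl' => hk.1 l ?_)
    split_ifs at hl <;> push_cast at hl' <;> omega
  have hV : Function.Surjective V := by
    intro P
    obtain ⟨z, hz, hP⟩ := exists_vertexAt P 0
    obtain ⟨t, m, hm, hy⟩ := hq ⟨z, hz⟩
    simp only at hy
    refine ⟨(t, decide (m = 1)), Subtype.ext (Eq.trans ?_ hP.symm)⟩
    rw [hy, predAt_shift]
    rcases hm with rfl | rfl <;> rfl
  exact finite_of_determined hV hDV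

theorem coveringMap_continuous (X : ShiftSpace.{u}) : Continuous X.coveringMap := by
  refine Continuous.subtype_mk (continuous_pi fun i => ?_) _
  exact (continuous_of_discreteTopology (f := X.fischerCover.label)).comp
    ((continuous_apply i).comp continuous_subtype_val)

theorem coveringMap_shift {n : ℤ} {e e' : X.fischerCover.edgeShift}
    (h : (e' : ℤ → X.fischerCover.Edge) = shift n (e : ℤ → X.fischerCover.Edge)) :
    (X.coveringMap e' : ℤ → X.Alphabet) = shift n (X.coveringMap e : ℤ → X.Alphabet) := by
  funext i
  exact congrArg X.fischerCover.label (congrFun h i)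

namespace CoverCode

open Topology

variable {f : X.points → Y.points} {k : X.points → ℤ → ℤ}

theorem finite_iff (h : CoverCode f k) :
    Finite X.kriegerCover.Vertex ↔ Finite Y.kriegerCover.Vertex := by
  constructor
  · intro
    obtain ⟨M, hM⟩ := h.forth 1
    exact finite_vertex_of_determined id f M hM h.exists_shift
  · intro
    obtain ⟨M, hM⟩ := h.back 1
    exact finite_vertex_of_determined f id M hM fun y => ⟨y, 0, Or.inl rfl, by simp⟩

theorem exists_forth (h : CoverCode f k) (hY : Finite Y.kriegerCover.Vertex) : ∃ M : ℕ → ℕ,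
    (∀ (N : ℕ) (w w' : X.points), X.KAgree (M N) w w' → Y.KAgree N (f w) (f w')) ∧
      ∀ (N : ℕ) (w : X.points), X.InFischer w (M N + 1) → Y.InFischer (f w) (N + 1) := by
  choose M₁ h₁ using h.forth
  choose M₂ h₂ using h.forthFischer hY
  exact ⟨fun N => max (M₁ N) (M₂ N), fun N w w' hw => h₁ N w w' (hw.mono (le_max_left _ _)),
    fun N w hw => h₂ N w (hw.mono (by simp))⟩

theorem exists_back (h : CoverCode f k) (hX : Finite X.kriegerCover.Vertex) : ∃ M : ℕ → ℕ,
    (∀ (N : ℕ) (w w' : X.points), Y.KAgree (M N) (f w) (f w') → X.KAgree N w w') ∧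
      ∀ (N : ℕ) (w : X.points), Y.InFischer (f w) (M N + 1) → X.InFischer w (N + 1) := by
  choose M₁ h₁ using h.back
  choose M₂ h₂ using h.backFischer hX
  exact ⟨fun N => max (M₁ N) (M₂ N), fun N w w' hw => h₁ N w w' (hw.mono (le_max_left _ _)),
    fun N w hw => h₂ N w (hw.mono (by simp))⟩

/-- `F e` is the limit of the points `f w`, where `w` runs through points approximating `e`. Every
property of `F` is checked on a window by passing to one such `w` with a large enough radius. -/
theorem exists_lift (h : CoverCode f k) (hX : Finite X.kriegerCover.Vertex) :
    ∃ F : X.fischerCover.edgeShift → Y.fischerCover.edgeShift,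
      OrbitCode F (fun e => k (X.coveringMap e)) ∧
        ∀ e, Y.coveringMap (F e) = f (X.coveringMap e) := by
  obtain ⟨M, hK, hF⟩ := h.exists_forth (h.finite_iff.1 hX)
  obtain ⟨M', hK', hF'⟩ := h.exists_back hX
  have hlift : ∀ e : X.fischerCover.edgeShift, ∃ e' : Y.fischerCover.edgeShift,
      ∀ N (w : X.points), X.Agree (M N) e w → Y.Agree N e' (f w) := by
    rintro ⟨e, he⟩
    obtain ⟨e', he', h'⟩ := exists_transfer (e := e) id f M hK hF fun N => by
      obtain ⟨w, hw, hA⟩ := exists_agree he N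
      exact ⟨⟨w, hw⟩, hA⟩
    exact ⟨⟨e', he'⟩, h'⟩
  choose F hA using hlift
  have hex : ∀ (e : X.fischerCover.edgeShift) N, ∃ w : X.points, X.Agree N e w := fun e N => by
    obtain ⟨w, hw, hA⟩ := exists_agree e.2 N
    exact ⟨⟨w, hw⟩, hA⟩
  have hcov : ∀ e, Y.coveringMap (F e) = f (X.coveringMap e) := by
    intro e
    refine Subtype.ext (funext fun i => ?_)
    have hfi : ∀ᶠ x in 𝓝 (X.coveringMap e),
        (f x : ℤ → Y.Alphabet) i = (f (X.coveringMap e) : ℤ → Y.Alphabet) i := by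
      have hc : Continuous fun x => (f x : ℤ → Y.Alphabet) i :=
        (continuous_apply i).comp (continuous_subtype_val.comp h.orbitCode.continuous)
      exact hc.continuousAt.eventually
        ((isOpen_discrete {(f (X.coveringMap e) : ℤ → Y.Alphabet) i}).mem_nhds rfl)
    obtain ⟨L, hL⟩ := mem_nhds_iff_window.1 hfi
    obtain ⟨w, hw⟩ := hex e (max L (M i.natAbs))
    have h1 : (f w : ℤ → Y.Alphabet) i = (f (X.coveringMap e) : ℤ → Y.Alphabet) i :=
      hL w fun j hj => (hw.label_eq (hj.trans (le_max_left _ _))).symm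
    rw [← h1]
    exact (hA e i.natAbs w (hw.mono (le_max_right _ _))).label_eq le_rfl
  have hcont : Continuous F := by
    refine Continuous.subtype_mk (f := fun e => (F e : ℤ → Y.fischerCover.Edge))
      (continuous_pi fun i => ?_) fun e => (F e).2
    refine ((IsLocallyConstant.iff_eventually_eq _).2 fun e => ?_).continuous
    refine mem_nhds_iff_window.2 ⟨M i.natAbs, fun e' he' => ?_⟩
    obtain ⟨w, hw⟩ := hex e (M i.natAbs)
    exact (hA e' _ w (hw.congr_left he')).eq_at (hA e _ w hw) le_rfl
  have hinj : Function.Injective F := by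
    intro e e' hee
    refine Subtype.ext (Agree.ext fun N => ?_)
    -- Radius `M (M' N)` makes the images agree to level `M' N`, which `hK'` turns into agreement of
    -- the points to level `N`.
    obtain ⟨w, hw⟩ := hex e (max N (M (M' N)))
    obtain ⟨w', hw'⟩ := hex e' (max N (M (M' N)))
    have h1 := hA e _ w (hw.mono (le_max_right _ _))
    have h2 := hA e' _ w' (hw'.mono (le_max_right _ _))
    rw [← hee] at h2
    exact ⟨w', (hw.mono (le_max_left _ _)).congr (hK' N _ _ (h1.kAgree h2)),
      hw'.mono (le_max_left _ _)⟩
  -- The range of `f` is open, so points approximating a path whose labels lie in this range are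
  -- themselves of the form `f w`, and the path can be transferred back.
  have hrange : ∀ e', Y.coveringMap e' ∈ Set.range f → e' ∈ Set.range F := by
    intro e' he'
    obtain ⟨L, hL⟩ := mem_nhds_iff_window.1 (h.orbitCode.isOpenMap.isOpen_range.mem_nhds he')
    have hex' : ∀ N, ∃ w : X.points, Y.Agree N e' (f w) := by
      intro N
      obtain ⟨u, hu, hAu⟩ := exists_agree e'.2 (max L N)
      obtain ⟨w, hw⟩ := hL ⟨u, hu⟩ fun i hi => (hAu.label_eq (hi.trans (le_max_left _ _))).symm
      refine ⟨w, ?_⟩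
      rw [hw]
      exact hAu.mono (le_max_right _ _)
    obtain ⟨e, he, hA'⟩ := exists_transfer f id M' hK' hF' hex'
    refine ⟨⟨e, he⟩, Subtype.ext (Agree.ext fun N => ?_)⟩
    obtain ⟨w, hw⟩ := hex' (max N (M' (M N)))
    exact ⟨f w, hA ⟨e, he⟩ N w (hA' (M N) w (hw.mono (le_max_right _ _))),
      hw.mono (le_max_left _ _)⟩
  have hshift : ∀ {n : ℤ} {e e₁ : X.fischerCover.edgeShift},
      (e₁ : ℤ → X.fischerCover.Edge) = shift n (e : ℤ → X.fischerCover.Edge) →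
      (F e₁ : ℤ → Y.fischerCover.Edge) =
        shift (k (X.coveringMap e) n) (F e : ℤ → Y.fischerCover.Edge) := by
    intro n e e₁ he
    refine Agree.ext fun N => ?_
    obtain ⟨L, hL⟩ := mem_nhds_iff_window.1 (h.orbitCode.eventually_k (X.coveringMap e) n)
    set m := k (X.coveringMap e) n with hm
    -- The summands serve three demands: the cocycle of `w` at `n` is that of the labels of `e`, the
    -- shift by `n` keeps radius `M N`, and the image keeps radius `N` after the shift by `m`.
    obtain ⟨w, hw⟩ := hex e (L + (M N + n.natAbs) + M (N + m.natAbs))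
    have hk : k w n = m := hL w fun i hi => (hw.label_eq (by omega)).symm
    let w₁ : X.points := ⟨shift n w, X.shift_mem_points n _ w.2⟩
    have h1 : (f w₁ : ℤ → Y.Alphabet) = shift m (f w : ℤ → Y.Alphabet) := by
      rw [← hk]; exact h.orbitCode.map_shift rfl
    refine ⟨f w₁, hA e₁ N w₁ ?_, ?_⟩
    · rw [he]; exact hw.shift (by omega)
    · rw [h1]; exact (hA e _ w (hw.mono (by omega))).shift le_rfl
  refine ⟨F, ⟨hcont, ?_, fun e => h.orbitCode.k_zero _, fun e => h.orbitCode.k_lt _, hshift,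
    fun he => h.orbitCode.k_shift (coveringMap_shift he),
    fun e n => X.coveringMap_continuous.continuousAt.eventually (h.orbitCode.eventually_k _ n),
    fun e' => ?_, fun {e e'} m he => ?_⟩, hcov⟩
  -- By compactness `F` is a closed embedding, and its range is the preimage of the open range of
  -- `f`.
  · have hr : Set.range F = Y.coveringMap ⁻¹' Set.range f := by
      refine Set.Subset.antisymm ?_ hrange
      rintro _ ⟨e, rfl⟩
      exact ⟨_, (hcov e).symm⟩
    refine IsOpenEmbedding.isOpenMap ⟨(hcont.isClosedEmbedding hinj).isEmbedding, ?_⟩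
    rw [hr]
    exact h.orbitCode.isOpenMap.isOpen_range.preimage Y.coveringMap_continuous
  · obtain ⟨x, m, hx⟩ := h.orbitCode.exists_shift (Y.coveringMap e')
    let e'' : Y.fischerCover.edgeShift :=
      ⟨shift (-m) e', LabelledGraph.shift_mem_edgeShift _ _ e'.2⟩
    obtain ⟨e, he⟩ := hrange e'' ⟨x, Subtype.ext (by
      rw [coveringMap_shift (n := -m) (e := e') (e' := e'') rfl, hx, ← shift_add]; simp)⟩
    refine ⟨e, m, ?_⟩
    rw [he]
    change _ = shift m (shift (-m) (e' : ℤ → Y.fischerCover.Edge))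
    rw [← shift_add]; simp
  · have h1 := coveringMap_shift he
    rw [hcov, hcov] at h1
    obtain ⟨n, hn, -⟩ := h.orbitCode.of_shift h1
    refine ⟨n, hn, ?_⟩
    have h2 := hshift (n := n) (e := e)
      (e₁ := ⟨shift n e, LabelledGraph.shift_mem_edgeShift _ _ e.2⟩) rfl
    rw [hn, ← he] at h2
    exact congrArg Subtype.val (hinj (Subtype.ext h2)).symm

theorem exists_flowEquivalence (h : CoverCode f k) (hX : Finite X.kriegerCover.Vertex) :
    ∃ (φ : Suspension X.points ≃ₜ Suspension Y.points)
      (ψ : Suspension X.fischerCover.edgeShift ≃ₜ Suspension Y.fischerCover.edgeShift),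
      IsFlowEquivalence φ ∧ IsFlowEquivalence ψ ∧
        φ ∘ X.coveringSuspension = Y.coveringSuspension ∘ ψ := by
  obtain ⟨F, hF, hcov⟩ := h.exists_lift hX
  refine ⟨h.orbitCode.suspHomeomorph Y.shift_mem_points,
    hF.suspHomeomorph LabelledGraph.shift_mem_edgeShift, h.orbitCode.isFlowEquivalence _,
    hF.isFlowEquivalence _, ?_⟩
  funext p
  obtain ⟨e, t, rfl⟩ := p.exists_rep
  change Suspension.mk (f (X.coveringMap e)) _ = Suspension.mk (Y.coveringMap (F e)) _
  rw [hcov]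

end CoverCode

end ShiftSpace

namespace ShiftSpace

variable {X Y : ShiftSpace.{u}}

/-! ### Sliding block codes and conjugacies -/

theorem map_shift_of_commute {f : X.points → Y.points}
    (hf : ∀ x, f (X.shiftMap x) = Y.shiftMap (f x)) {n : ℤ} {x x' : X.points}
    (h : (x' : ℤ → X.Alphabet) = shift n (x : ℤ → X.Alphabet)) :
    (f x' : ℤ → Y.Alphabet) = shift n (f x : ℤ → Y.Alphabet) := by
  have h1 : ∀ z : X.points, (f (X.shiftMap z) : ℤ → Y.Alphabet) = shift 1 (f z) :=
    fun z => congrArg Subtype.val (hf z)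
  induction n using Int.induction_on generalizing x' with
  | zero =>
    have : x' = x := Subtype.ext (by rw [h]; simp)
    rw [this]; simp
  | succ n ih =>
    let z : X.points := ⟨shift n x, X.shift_mem_points _ _ x.2⟩
    have : x' = X.shiftMap z := Subtype.ext (by rw [h, shift_add]; rfl)
    rw [this, h1, ih (x' := z) rfl, ← shift_add]
  | pred n ih =>
    have h2 := ih (x' := X.shiftMap x') (by
      change shift 1 (x' : ℤ → X.Alphabet) = _
      rw [h, ← shift_add]; congr 1; ring)
    rw [h1] at h2
    rw [sub_eq_add_neg, shift_add, ← h2, ← shift_add]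
    simp

/-- The Curtis–Hedlund–Lyndon theorem: the sets on which radius `N` decides the symbol at `0` are
open and increase to the compact space of points. -/
theorem exists_radius {f : X.points → Y.points} (hc : Continuous f)
    (hf : ∀ x, f (X.shiftMap x) = Y.shiftMap (f x)) :
    ∃ r : ℕ, ∀ (x x' : X.points) (i : ℤ),
      (∀ j, i - r ≤ j → j ≤ i + r → (x : ℤ → X.Alphabet) j = (x' : ℤ → X.Alphabet) j) →
      (f x : ℤ → Y.Alphabet) i = (f x' : ℤ → Y.Alphabet) i := by
  let U : ℕ → Set X.points := fun N => {x | ∀ x' : X.points,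
    (∀ j : ℤ, j.natAbs ≤ N → (x' : ℤ → X.Alphabet) j = (x : ℤ → X.Alphabet) j) →
      (f x' : ℤ → Y.Alphabet) 0 = (f x : ℤ → Y.Alphabet) 0}
  have hU : ∀ N, IsOpen (U N) := by
    intro N
    rw [isOpen_iff_mem_nhds]
    intro x hx
    refine mem_nhds_iff_window.2 ⟨N, fun y hy x' hx' => ?_⟩
    rw [hx x' fun j hj => (hx' j hj).trans (hy j hj), hx y hy]
  have hcov : Set.univ ⊆ ⋃ N, U N := by
    intro x _
    have hc' : Continuous fun x => (f x : ℤ → Y.Alphabet) 0 :=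
      (continuous_apply 0).comp (continuous_subtype_val.comp hc)
    obtain ⟨N, hN⟩ := mem_nhds_iff_window.1 (hc'.continuousAt.preimage_mem_nhds
      ((isOpen_discrete {(f x : ℤ → Y.Alphabet) 0}).mem_nhds rfl))
    exact Set.mem_iUnion.2 ⟨N, hN⟩
  have hdir : Directed (· ⊆ ·) U := by
    refine (monotone_nat_of_le_succ fun N x hx x' hx' => hx x' fun j hj => ?_).directed_le
    exact hx' j (by omega)
  obtain ⟨r, hr⟩ := isCompact_univ.elim_directed_cover U hU hcov hdir
  refine ⟨r, fun x x' i h => ?_⟩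
  let z : X.points := ⟨shift i x, X.shift_mem_points _ _ x.2⟩
  let z' : X.points := ⟨shift i x', X.shift_mem_points _ _ x'.2⟩
  have h1 := hr (Set.mem_univ z') z fun j hj => h (i + j) (by omega) (by omega)
  rw [map_shift_of_commute hf (x := x) (x' := z) rfl,
    map_shift_of_commute hf (x := x') (x' := z') rfl] at h1
  simpa using h1

/-- Two inverse maps that are sliding block codes of radius `r`. -/
structure BlockConjugacy (f : X.points → Y.points) (g : Y.points → X.points) (r : ℕ) : Prop where
  left_inv : ∀ x, g (f x) = x
  right_inv : ∀ y, f (g y) = y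
  map_eq : ∀ {x x' : X.points} {i : ℤ},
    (∀ j, i - r ≤ j → j ≤ i + r → (x : ℤ → X.Alphabet) j = (x' : ℤ → X.Alphabet) j) →
    (f x : ℤ → Y.Alphabet) i = (f x' : ℤ → Y.Alphabet) i
  inv_eq : ∀ {y y' : Y.points} {i : ℤ},
    (∀ j, i - r ≤ j → j ≤ i + r → (y : ℤ → Y.Alphabet) j = (y' : ℤ → Y.Alphabet) j) →
    (g y : ℤ → X.Alphabet) i = (g y' : ℤ → X.Alphabet) i

namespace BlockConjugacy

variable {f : X.points → Y.points} {g : Y.points → X.points} {r : ℕ}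

theorem symm (h : BlockConjugacy f g r) : BlockConjugacy g f r :=
  ⟨h.right_inv, h.left_inv, h.inv_eq, h.map_eq⟩

/-- Glue a past to `f w` at `i - 3 * r` and apply `g`: the result follows `w` from `i - 2 * r` on,
so its future from `i` may be replaced by that of `w'`. Applying `f` returns the same past followed
by `f w'`. Agreement from `i - 4 * r` is needed because `f` is compared from `i - 3 * r` on and
looks `r` places to the left. -/
theorem predAt_subset (h : BlockConjugacy f g r) {w w' : X.points} {i : ℤ}
    (hp : X.predAt w i ⊆ X.predAt w' i)
    (hw : ∀ j, i - 4 * r ≤ j → j < i → (w : ℤ → X.Alphabet) j = (w' : ℤ → X.Alphabet) j) :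
    Y.predAt (f w) (i - 3 * r) ⊆ Y.predAt (f w') (i - 3 * r) := by
  rw [predAt_subset_iff]
  intro y₀ hy
  obtain ⟨y, hyd⟩ : ∃ y : Y.points, (y : ℤ → Y.Alphabet) = splice (i - 3 * r) y₀ (f w) :=
    ⟨⟨_, hy⟩, rfl⟩
  have hvw : ∀ j, i - 2 * r ≤ j → (g y : ℤ → X.Alphabet) j = (w : ℤ → X.Alphabet) j := by
    intro j hj
    rw [← h.left_inv w]
    refine h.inv_eq fun l hl _ => ?_
    rw [hyd, splice_of_le (by omega)]
  have hmem : splice i (g y : ℤ → X.Alphabet) w' ∈ X.points := by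
    refine predAt_subset_iff.1 hp _ ?_
    rw [splice_eq (fun _ _ => rfl) fun j hj => (hvw j (by omega)).symm]
    exact (g y).2
  obtain ⟨v, hv⟩ : ∃ v : X.points, (v : ℤ → X.Alphabet) = splice i (g y) w' := ⟨⟨_, hmem⟩, rfl⟩
  have hfv : ∀ j, j < i - r → (f v : ℤ → Y.Alphabet) j = (y : ℤ → Y.Alphabet) j := by
    intro j hj
    rw [← h.right_inv y]
    refine h.map_eq fun l _ hl => ?_
    rw [hv, splice_of_lt (by omega)]
  have : splice (i - 3 * r) y₀ (f w') = f v := by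
    refine splice_eq (fun j hj => ?_) fun j hj => ?_
    · rw [hfv j (by omega), hyd, splice_of_lt hj]
    · rcases lt_or_ge j (i - r) with hj' | hj'
      · rw [hfv j hj', hyd, splice_of_le hj]
        exact h.map_eq fun l h₁ h₂ => (hw l (by omega) (by omega)).symm
      · refine h.map_eq fun l h₁ h₂ => ?_
        rw [hv]
        rcases lt_or_ge l i with hl | hl
        · rw [splice_of_lt hl, hvw l (by omega), hw l (by omega) hl]
        · rw [splice_of_le hl]
  rw [this]
  exact (f v).2

theorem predAt_eq (h : BlockConjugacy f g r) {w w' : X.points} {i : ℤ}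
    (hp : X.predAt w i = X.predAt w' i)
    (hw : ∀ j, i - 4 * r ≤ j → j < i → (w : ℤ → X.Alphabet) j = (w' : ℤ → X.Alphabet) j) :
    Y.predAt (f w) (i - 3 * r) = Y.predAt (f w') (i - 3 * r) :=
  (h.predAt_subset hp.le hw).antisymm
    (h.predAt_subset hp.ge fun j h₁ h₂ => (hw j h₁ h₂).symm)

/-- Split the vertex of `f w` at `j = i + 3 * r` into non-decomposable ones and pull the pieces `q`
back by `g`. Their vertices at `i` cover that of `w`, so one equals it. Following the past of `w` by
the future of that `g q` gives a point whose image has the vertex of `f w` at `i - 3 * r` and a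
non-decomposable vertex at `j`. -/
theorem inFischer_of_nonDecAt (h : BlockConjugacy f g r) [Finite Y.kriegerCover.Vertex]
    {w : X.points} {i : ℤ} (hd : X.NonDecAt w i) : Y.InFischer (f w) (i - 3 * r) := by
  obtain ⟨j, hj⟩ : ∃ j, j = i + 3 * r := ⟨_, rfl⟩
  -- The two agreement conditions keep each piece inside the vertex of `w`: when the future of `q`
  -- from `j` is exchanged for that of `f w`, `g` is affected only from `j - r` on, where it reads
  -- from `j - 2 * r = i + r` on.
  obtain ⟨_, ⟨q, rfl, hqd, hqs, hqw, hgq⟩, hpq⟩ := hd.2 {u | ∃ q : Y.points, g q = u ∧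
      Y.NonDecAt q j ∧ Y.predAt q j ⊆ Y.predAt (f w) j ∧
      (∀ l, i + r ≤ l → l < j → (q : ℤ → Y.Alphabet) l = (f w : ℤ → Y.Alphabet) l) ∧
      (∀ l, i ≤ l → l < j - r → (g q : ℤ → X.Alphabet) l = (w : ℤ → X.Alphabet) l)} (by
    rintro _ ⟨q, rfl, -⟩
    exact (g q).2) (by
    rintro _ ⟨q, rfl, -, hqs, hqw, hgq⟩
    rw [predAt_subset_iff]
    intro u₀ hu₀
    obtain ⟨u, hu⟩ : ∃ u : X.points, (u : ℤ → X.Alphabet) = splice i u₀ (g q) := ⟨⟨_, hu₀⟩, rfl⟩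
    have hfu : ∀ l, i + r ≤ l → (f u : ℤ → Y.Alphabet) l = (q : ℤ → Y.Alphabet) l := by
      intro l hl
      rw [← h.right_inv q]
      refine h.map_eq fun m hm _ => ?_
      rw [hu, splice_of_le (by omega)]
    have hmem : splice j (f u : ℤ → Y.Alphabet) (f w) ∈ Y.points := by
      refine predAt_subset_iff.1 hqs _ ?_
      rw [splice_eq (fun _ _ => rfl) fun l hl => (hfu l (by omega)).symm]
      exact (f u).2
    obtain ⟨y, hy⟩ : ∃ y : Y.points, (y : ℤ → Y.Alphabet) = splice j (f u) (f w) :=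
      ⟨⟨_, hmem⟩, rfl⟩
    have hgy : ∀ l, l < j - r → (g y : ℤ → X.Alphabet) l = (u : ℤ → X.Alphabet) l := by
      intro l hl
      rw [← h.left_inv u]
      refine h.inv_eq fun m _ hm => ?_
      rw [hy, splice_of_lt (by omega)]
    have : splice i u₀ (w : ℤ → X.Alphabet) = g y := by
      refine splice_eq (fun l hl => ?_) fun l hl => ?_
      · rw [hgy l (by omega), hu, splice_of_lt hl]
      · rcases lt_or_ge l (j - r) with hl' | hl'
        · rw [hgy l hl', hu, splice_of_le hl, hgq l hl hl']
        · rw [← h.left_inv w]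
          refine h.inv_eq fun m hm _ => ?_
          rw [hy]
          rcases lt_or_ge m j with hm' | hm'
          · rw [splice_of_lt hm', hfu m (by omega), hqw m (by omega) hm']
          · rw [splice_of_le hm']
    rw [this]
    exact (g y).2) (by
    intro v₀ hv₀
    obtain ⟨v, hv⟩ : ∃ v : X.points, (v : ℤ → X.Alphabet) = splice i v₀ w := ⟨⟨_, hv₀⟩, rfl⟩
    have hfv : ∀ l, i + r ≤ l → (f v : ℤ → Y.Alphabet) l = (f w : ℤ → Y.Alphabet) l := by
      intro l hl
      refine h.map_eq fun m hm _ => ?_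
      rw [hv, splice_of_le (by omega)]
    obtain ⟨q₀, hq₀, hqs, hqm⟩ := exists_nonDecAt (v := (f v : ℤ → Y.Alphabet)) (w := f w) (i := j) (f w).2 (by
      rw [splice_eq (fun _ _ => rfl) fun l hl => (hfv l (by omega)).symm]
      exact (f v).2)
    obtain ⟨q, hq⟩ : ∃ q : Y.points, (q : ℤ → Y.Alphabet) = splice j (f v) q₀ := ⟨⟨_, hqm⟩, rfl⟩
    have hp : Y.predAt q j = Y.predAt q₀ j := by rw [hq, predAt_splice le_rfl]
    have hgq : ∀ l, l < j - r → (g q : ℤ → X.Alphabet) l = (v : ℤ → X.Alphabet) l := by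
      intro l hl
      rw [← h.left_inv v]
      refine h.inv_eq fun m _ hm => ?_
      rw [hq, splice_of_lt (by omega)]
    refine ⟨g q, ⟨q, rfl, hq₀.congr q.2 hp.symm, hp.le.trans hqs, fun l h₁ h₂ => ?_,
      fun l h₁ h₂ => ?_⟩, ?_⟩
    · rw [hq, splice_of_lt h₂, hfv l h₁]
    · rw [hgq l h₂, hv, splice_of_le h₁]
    · rw [splice_eq (fun l hl => ?_) fun _ _ => rfl]
      · exact (g q).2
      · rw [hgq l (by omega), hv, splice_of_lt hl])
  obtain ⟨u, hu⟩ : ∃ u : X.points, (u : ℤ → X.Alphabet) = splice i w (g q) :=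
    ⟨⟨_, splice_mem w.2 hpq.ge⟩, rfl⟩
  have hpu : X.predAt u i = X.predAt w i := by rw [hu, predAt_splice le_rfl, hpq]
  refine ⟨(f w).2, f u, (f u).2, j, by omega, h.predAt_eq hpu fun l _ hl => ?_,
    hqd.congr (f u).2 (predAt_congr fun l hl => ?_)⟩
  · rw [hu, splice_of_lt hl]
  · rw [← h.right_inv q]
    refine h.map_eq fun m hm _ => ?_
    rw [hu, splice_of_le (by omega)]

theorem inFischer (h : BlockConjugacy f g r) [Finite Y.kriegerCover.Vertex]
    {w : X.points} {i : ℤ} (hd : X.InFischer w i) : Y.InFischer (f w) (i - 3 * r) := by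
  obtain ⟨w', hw', h₁, h₂, j, hij, hd'⟩ := hd.exists_eq_left
  have h3 : Y.InFischer (f ⟨w', hw'⟩) (i - 3 * r) :=
    (h.inFischer_of_nonDecAt (w := ⟨w', hw'⟩) hd').mono (by omega)
  exact h3.congr (f w).2 (h.predAt_eq (w := ⟨w', hw'⟩) h₂ fun l _ hl => h₁ l hl)

theorem kAgree (h : BlockConjugacy f g r) {N : ℕ} {w w' : X.points}
    (hK : X.KAgree (N + 3 * r) w w') : Y.KAgree N (f w) (f w') := by
  refine ⟨fun i hi => h.map_eq fun j _ _ => hK.1 j (by omega), ?_⟩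
  have := h.predAt_eq hK.2 fun j _ _ => hK.1 j (by push_cast at *; omega)
  rwa [show ((N + 3 * r : ℕ) : ℤ) + 1 - 3 * r = N + 1 by push_cast; ring] at this

theorem inFischer_nat (h : BlockConjugacy f g r) [Finite Y.kriegerCover.Vertex] {N : ℕ}
    {w : X.points} (hF : X.InFischer w ((N + 3 * r : ℕ) + 1)) : Y.InFischer (f w) (N + 1) := by
  have := h.inFischer hF
  rwa [show ((N + 3 * r : ℕ) : ℤ) + 1 - 3 * r = N + 1 by push_cast; ring] at this

end BlockConjugacy

theorem Conjugate.exists_coverCode (h : X.Conjugate Y) :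
    ∃ (f : X.points → Y.points) (k : X.points → ℤ → ℤ), CoverCode f k := by
  obtain ⟨f, hb, hc, hf⟩ := h
  let e : X.points ≃ₜ Y.points := Continuous.homeoOfEquivCompactToT2 (f := Equiv.ofBijective f hb) hc
  have hg : ∀ y, e.symm (Y.shiftMap y) = X.shiftMap (e.symm y) := by
    intro y
    rw [e.symm_apply_eq]
    change _ = f _
    rw [hf]
    exact congrArg _ (e.apply_symm_apply y).symm
  obtain ⟨r₁, h₁⟩ := exists_radius hc hf
  obtain ⟨r₂, h₂⟩ := exists_radius e.symm.continuous hg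
  have hB : BlockConjugacy f e.symm (max r₁ r₂) :=
    ⟨e.symm_apply_apply, e.apply_symm_apply,
      fun {x x' i} h => h₁ x x' i fun j hj hj' => h j (by omega) (by omega),
      fun {x x' i} h => h₂ x x' i fun j hj hj' => h j (by omega) (by omega)⟩
  have hs : ∀ y : Y.points, (y : ℤ → Y.Alphabet) = shift 0 (f (e.symm y) : ℤ → Y.Alphabet) := by
    intro y
    rw [hB.right_inv, shift_zero]
  refine ⟨f, fun _ n => n, ⟨hc, e.isOpenMap, fun _ => rfl, fun _ n => by omega,
    map_shift_of_commute hf, fun _ m => by omega, fun _ _ => Filter.Eventually.of_forall fun _ => rfl,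
    fun y => ⟨_, 0, hs y⟩, fun {x x' m} hm => ⟨m, rfl, ?_⟩⟩,
    fun y => ⟨_, 0, Or.inl rfl, hs y⟩, fun N => ⟨_, fun w w' => hB.kAgree⟩,
    fun N => ⟨N + 3 * max r₁ r₂, fun w w' hK => ?_⟩, fun _ N => ⟨_, fun w => hB.inFischer_nat⟩,
    fun _ N => ⟨N + 3 * max r₁ r₂, fun w hF => ?_⟩⟩
  · have := map_shift_of_commute hg hm
    rwa [hB.left_inv, hB.left_inv] at this
  · have := hB.symm.kAgree hK
    rwa [hB.left_inv, hB.left_inv] at this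
  · have := hB.symm.inFischer_nat hF
    rwa [hB.left_inv] at this

end ShiftSpace

/-! ### Symbol expansion as a map of bi-infinite sequences -/

/-- The partial sums of a function on the integers, with value `0` at `0`. -/
def intSum (g : ℤ → ℤ) : ℤ → ℤ
  | Int.ofNat n => ∑ i ∈ Finset.range n, g i
  | Int.negSucc n => -∑ i ∈ Finset.range (n + 1), g (-(i + 1))

theorem intSum_succ (g : ℤ → ℤ) (n : ℤ) : intSum g (n + 1) = intSum g n + g n := by
  rcases n with n | n
  · exact Finset.sum_range_succ _ _
  · rcases n with _ | n
    · change (0 : ℤ) = -(∑ i ∈ Finset.range 1, g (-(i + 1))) + g (-1)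
      simp
    · have h : Int.negSucc (n + 1) + 1 = Int.negSucc n := by omega
      rw [h]
      change -(∑ i ∈ Finset.range (n + 1), g (-(i + 1))) =
        -(∑ i ∈ Finset.range (n + 1 + 1), g (-(i + 1))) + g (Int.negSucc (n + 1))
      rw [Finset.sum_range_succ _ (n + 1)]
      have h' : (-(((n + 1 : ℕ) : ℤ) + 1)) = Int.negSucc (n + 1) := by omega
      rw [h']
      ring

theorem int_eq_of_succ_sub {K K' : ℤ → ℤ} (h₀ : K 0 = K' 0)
    (h : ∀ n, K (n + 1) - K n = K' (n + 1) - K' n) (n : ℤ) : K n = K' n := by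
  induction n using Int.induction_on with
  | zero => exact h₀
  | succ n ih => have := h n; omega
  | pred n ih =>
    have := h (-n - 1)
    rw [sub_add_cancel] at this
    omega

namespace ShiftSpace

section Expand

variable {A B : Type u} (a : A) (ι : A → B) (b : B)

open Classical in
/-- The position in the expansion of `x` of the letter `x n`. -/
noncomputable def expandPos (x : ℤ → A) : ℤ → ℤ := intSum fun i => if x i = a then 2 else 1

variable {a} {x x' : ℤ → A}

theorem expandPos_zero : expandPos a x 0 = 0 := rfl

theorem expandPos_succ_of_eq {n : ℤ} (h : x n = a) :
    expandPos a x (n + 1) = expandPos a x n + 2 := by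
  unfold expandPos
  rw [intSum_succ, if_pos h]

theorem expandPos_succ_of_ne {n : ℤ} (h : x n ≠ a) :
    expandPos a x (n + 1) = expandPos a x n + 1 := by
  unfold expandPos
  rw [intSum_succ, if_neg h]

theorem expandPos_lt (n : ℤ) : expandPos a x n < expandPos a x (n + 1) := by
  by_cases h : x n = a
  · rw [expandPos_succ_of_eq h]; omega
  · rw [expandPos_succ_of_ne h]; omega

theorem expandPos_succ_le (n : ℤ) : expandPos a x (n + 1) ≤ expandPos a x n + 2 := by
  by_cases h : x n = a
  · rw [expandPos_succ_of_eq h]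
  · rw [expandPos_succ_of_ne h]; omega

theorem expandPos_strictMono : StrictMono (expandPos a x) :=
  strictMono_int_of_lt_succ expandPos_lt

theorem le_expandPos (n : ℕ) : (n : ℤ) ≤ expandPos a x n := by
  have := le_apply_of_lt_succ (κ := expandPos a x) expandPos_lt n
  rwa [expandPos_zero, zero_add] at this

theorem expandPos_neg_le (n : ℕ) : expandPos a x (-n) ≤ -n := by
  have := apply_neg_le_of_lt_succ (κ := expandPos a x) expandPos_lt n
  rwa [expandPos_zero, zero_sub] at this

theorem expandPos_le (n : ℕ) : expandPos a x n ≤ 2 * n := by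
  induction n with
  | zero => exact le_rfl
  | succ n ih => have := expandPos_succ_le (a := a) (x := x) n; push_cast; omega

theorem le_expandPos_neg (n : ℕ) : -(2 * n : ℤ) ≤ expandPos a x (-n) := by
  induction n with
  | zero => exact le_rfl
  | succ n ih =>
    have := expandPos_succ_le (a := a) (x := x) (-((n + 1 : ℕ) : ℤ))
    rw [show -((n + 1 : ℕ) : ℤ) + 1 = -n by push_cast; ring] at this
    push_cast at *; omega

theorem expandPos_shift (n m : ℤ) :
    expandPos a (shift n x) m = expandPos a x (n + m) - expandPos a x n := by
  refine int_eq_of_succ_sub (K' := fun m => expandPos a x (n + m) - expandPos a x n) ?_ ?_ m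
  · simp [expandPos_zero]
  · intro m
    by_cases h : x (n + m) = a
    · rw [expandPos_succ_of_eq (by rwa [shift_apply]), ← add_assoc, expandPos_succ_of_eq h]; ring
    · rw [expandPos_succ_of_ne (by rwa [shift_apply]), ← add_assoc, expandPos_succ_of_ne h]; ring

theorem expandPos_congr {n : ℕ} (h : ∀ i : ℤ, 0 ≤ i → i < n → x i = x' i) :
    expandPos a x n = expandPos a x' n := by
  induction n with
  | zero => rfl
  | succ n ih =>
    have h1 := ih fun i h₁ h₂ => h i h₁ (by push_cast; omega)
    have h2 := h n (by omega) (by push_cast; omega)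
    push_cast
    by_cases ha : x n = a
    · rw [expandPos_succ_of_eq ha, expandPos_succ_of_eq (h2 ▸ ha), h1]
    · rw [expandPos_succ_of_ne ha, expandPos_succ_of_ne (h2 ▸ ha), h1]

theorem expandPos_neg_congr {n : ℕ} (h : ∀ i : ℤ, -n ≤ i → i < 0 → x i = x' i) :
    expandPos a x (-n) = expandPos a x' (-n) := by
  induction n with
  | zero => rfl
  | succ n ih =>
    have h1 := ih fun i h₁ h₂ => h i (by push_cast; omega) h₂
    have h2 := h (-((n + 1 : ℕ) : ℤ)) le_rfl (by push_cast; omega)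
    have h3 : -((n + 1 : ℕ) : ℤ) + 1 = -n := by push_cast; ring
    by_cases ha : x (-((n + 1 : ℕ) : ℤ)) = a
    · have h4 := expandPos_succ_of_eq ha
      have h5 := expandPos_succ_of_eq (x := x') (h2 ▸ ha)
      rw [h3] at h4 h5; omega
    · have h4 := expandPos_succ_of_ne ha
      have h5 := expandPos_succ_of_ne (x := x') (h2 ▸ ha)
      rw [h3] at h4 h5; omega

variable (a) in
open Classical in
/-- The expansion of `x`: the letters are renamed along `ι` and `b` is inserted after each `a`. -/
noncomputable def expand (x : ℤ → A) (p : ℤ) : B :=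
  if expandPos a x (exists_le_lt_succ (κ := expandPos a x) expandPos_lt p).choose = p then
    ι (x (exists_le_lt_succ (κ := expandPos a x) expandPos_lt p).choose) else b

theorem choose_eq {p n : ℤ} (h₁ : expandPos a x n ≤ p) (h₂ : p < expandPos a x (n + 1)) :
    (exists_le_lt_succ (κ := expandPos a x) expandPos_lt p).choose = n := by
  obtain ⟨h₃, h₄⟩ := (exists_le_lt_succ (κ := expandPos a x) expandPos_lt p).choose_spec
  have h5 := (expandPos_strictMono (a := a) (x := x)).lt_iff_lt.1 (h₃.trans_lt h₂)
  have h6 := (expandPos_strictMono (a := a) (x := x)).lt_iff_lt.1 (h₁.trans_lt h₄)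
  omega

variable {ι b}

@[simp] theorem expand_pos (n : ℤ) : expand a ι b x (expandPos a x n) = ι (x n) := by
  unfold expand
  rw [choose_eq le_rfl (expandPos_lt n), if_pos rfl]

theorem expand_pos_succ {n : ℤ} (h : x n = a) : expand a ι b x (expandPos a x n + 1) = b := by
  unfold expand
  rw [choose_eq (n := n) (by omega) (by rw [expandPos_succ_of_eq h]; omega), if_neg (by omega)]

theorem expand_zero : expand a ι b x 0 = ι (x 0) := expand_pos (x := x) 0

theorem expand_one (h : x 0 = a) : expand a ι b x 1 = b := expand_pos_succ h

/-- Every position of the expansion carries either a letter of `x` or the symbol inserted after an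
`a`. -/
theorem exists_pos (x : ℤ → A) (p : ℤ) :
    ∃ n, p < expandPos a x (n + 1) ∧
      (p = expandPos a x n ∨ x n = a ∧ p = expandPos a x n + 1) := by
  obtain ⟨n, h₁, h₂⟩ := exists_le_lt_succ (κ := expandPos a x) expandPos_lt p
  refine ⟨n, h₂, ?_⟩
  by_cases h : x n = a
  · rw [expandPos_succ_of_eq h] at h₂
    rcases eq_or_lt_of_le h₁ with h₃ | h₃
    · exact Or.inl h₃.symm
    · exact Or.inr ⟨h, by omega⟩
  · rw [expandPos_succ_of_ne h] at h₂
    exact Or.inl (by omega)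

theorem expand_shift (n : ℤ) :
    expand a ι b (shift n x) = shift (expandPos a x n) (expand a ι b x) := by
  funext p
  rw [shift_apply]
  obtain ⟨m, -, rfl | ⟨h, rfl⟩⟩ := exists_pos (a := a) (shift n x) p
  · rw [expand_pos, expandPos_shift, add_sub_cancel, expand_pos, shift_apply]
  · rw [expand_pos_succ h, expandPos_shift, ← add_assoc, add_sub_cancel,
      expand_pos_succ (show x (n + m) = a from h)]

theorem isExpansionOf_iff {y : ℤ → B} :
    IsExpansionOf a ι b x y ↔ ∃ m, y = shift m (expand a ι b x) := by
  constructor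
  · rintro ⟨k, h₁, h₂, h₃⟩
    have hk : ∀ n, k n = expandPos a x n + k 0 := by
      refine int_eq_of_succ_sub (by simp [expandPos_zero]) fun n => ?_
      by_cases h : x n = a
      · rw [expandPos_succ_of_eq h, (h₃ n h).1]; ring
      · rw [expandPos_succ_of_ne h, h₂ n h]; ring
    refine ⟨-k 0, funext fun p => ?_⟩
    rw [shift_apply]
    obtain ⟨n, -, h | ⟨h, h'⟩⟩ := exists_pos (a := a) x (-k 0 + p)
    · have hp : p = k n := by rw [hk]; omega
      rw [h, expand_pos, hp, h₁]
    · have hp : p = k n + 1 := by rw [hk]; omega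
      rw [h', expand_pos_succ h, hp, (h₃ n h).2]
  · rintro ⟨m, rfl⟩
    refine ⟨fun n => expandPos a x n - m, fun j => ?_, fun j h => ?_, fun j h => ⟨?_, ?_⟩⟩
    · rw [shift_apply, add_sub_cancel, expand_pos]
    · simp only [expandPos_succ_of_ne h]; ring
    · simp only [expandPos_succ_of_eq h]; ring
    · rw [shift_apply, show m + (expandPos a x j - m + 1) = expandPos a x j + 1 by ring,
        expand_pos_succ h]

theorem expand_congr {n : ℕ} (h : ∀ i : ℤ, 0 ≤ i → i < n → x i = x' i) {p : ℤ} (h₀ : 0 ≤ p)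
    (hp : p < expandPos a x n) : expand a ι b x p = expand a ι b x' p := by
  obtain ⟨m, hm, hc⟩ := exists_pos (a := a) x p
  have h1 : 0 < m + 1 := (expandPos_strictMono (a := a) (x := x)).lt_iff_lt.1 (h₀.trans_lt hm)
  have h2 : m < n := (expandPos_strictMono (a := a) (x := x)).lt_iff_lt.1
    (lt_of_le_of_lt (by rcases hc with hc | ⟨-, hc⟩ <;> omega) hp)
  lift m to ℕ using (by omega) with m
  have h3 : expandPos a x m = expandPos a x' m := expandPos_congr fun i hi hi' => h i hi (by omega)
  have h4 := h m (by omega) h2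
  rcases hc with rfl | ⟨hc, rfl⟩
  · rw [expand_pos, h3, expand_pos, h4]
  · rw [expand_pos_succ hc, h3, expand_pos_succ (h4 ▸ hc)]

theorem expand_neg_congr {n : ℕ} (h : ∀ i : ℤ, -n ≤ i → i < 0 → x i = x' i) {p : ℤ} (h₀ : p < 0)
    (hp : -n ≤ p) : expand a ι b x p = expand a ι b x' p := by
  obtain ⟨m, hm, hc⟩ := exists_pos (a := a) x p
  have h1 : m < 0 := (expandPos_strictMono (a := a) (x := x)).lt_iff_lt.1
    (lt_of_le_of_lt (by rcases hc with hc | ⟨-, hc⟩ <;> omega) h₀)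
  have h2 : -(n : ℤ) < m + 1 := (expandPos_strictMono (a := a) (x := x)).lt_iff_lt.1
    (((expandPos_neg_le n).trans hp).trans_lt hm)
  obtain ⟨l, rfl⟩ : ∃ l : ℕ, m = -l := ⟨m.natAbs, by omega⟩
  have h3 : expandPos a x (-l) = expandPos a x' (-l) :=
    expandPos_neg_congr fun i hi hi' => h i (by omega) hi'
  have h4 := h (-l) (by omega) h1
  rcases hc with rfl | ⟨hc, rfl⟩
  · rw [expand_pos, h3, expand_pos, h4]
  · rw [expand_pos_succ hc, h3, expand_pos_succ (h4 ▸ hc)]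

/-- Position `0` of an expansion carries the letter at `0`, so each half of the expansion depends
only on the corresponding half of the sequence. -/
theorem expand_splice (u v : ℤ → A) :
    expand a ι b (splice 0 u v) = splice 0 (expand a ι b u) (expand a ι b v) := by
  refine (splice_eq (fun p hp => ?_) fun p hp => ?_).symm
  · exact expand_neg_congr (x := u) (n := p.natAbs) (fun i _ hi => (splice_of_lt hi).symm) hp (by omega)
  · refine expand_congr (x := v) (n := p.natAbs + 1) (fun i hi _ => (splice_of_le hi).symm) hp ?_
    have := le_expandPos (a := a) (x := v) (p.natAbs + 1)
    omega

section Injective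

variable (hι : Function.Injective ι) (hb : b ∉ Set.range ι)
include hι

theorem eq_of_expand_eq {N : ℤ} (h : ∀ p, 0 ≤ p → p < N → expand a ι b x p = expand a ι b x' p)
    (n : ℕ) (hn : expandPos a x n < N) :
    expandPos a x n = expandPos a x' n ∧ x n = x' n := by
  have key : ∀ n : ℕ, expandPos a x n < N → expandPos a x n = expandPos a x' n → x n = x' n := by
    intro n hn hk
    have := h (expandPos a x n) (le_trans (by omega) (le_expandPos n)) hn
    rw [expand_pos, hk, expand_pos] at this
    exact hι this
  induction n with
  | zero => exact ⟨rfl, key 0 hn rfl⟩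
  | succ n ih =>
    obtain ⟨h1, h2⟩ := ih ((expandPos_strictMono (by simp)).trans hn)
    have h3 : expandPos a x ((n + 1 : ℕ) : ℤ) = expandPos a x' ((n + 1 : ℕ) : ℤ) := by
      push_cast
      by_cases ha : x n = a
      · rw [expandPos_succ_of_eq ha, expandPos_succ_of_eq (h2 ▸ ha), h1]
      · rw [expandPos_succ_of_ne ha, expandPos_succ_of_ne (h2 ▸ ha), h1]
    exact ⟨h3, key _ hn h3⟩

include hb

/-- Decoding leftwards: the preceding symbol is `b` exactly when the preceding letter is `a`,
because `b` is not a renamed letter. The factor `2` bounds the room taken by one letter. -/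
theorem eq_of_expand_eq_neg {N : ℤ}
    (h : ∀ p, -N ≤ p → p < 0 → expand a ι b x p = expand a ι b x' p) (n : ℕ) (hn : 2 * n ≤ N) :
    expandPos a x (-n) = expandPos a x' (-n) ∧ ∀ i : ℤ, -n ≤ i → i < 0 → x i = x' i := by
  induction n with
  | zero => exact ⟨rfl, fun i h₁ h₂ => absurd h₁ (by simpa using h₂)⟩
  | succ n ih =>
    obtain ⟨h1, h2⟩ := ih (by push_cast at hn; omega)
    obtain ⟨m, hm⟩ : ∃ m : ℤ, m = -((n + 1 : ℕ) : ℤ) := ⟨_, rfl⟩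
    have hm1 : -(n : ℤ) = m + 1 := by rw [hm]; push_cast; ring
    have hp := le_expandPos_neg (a := a) (x := x) n
    have hp' := expandPos_neg_le (a := a) (x := x) n
    have h3 := h (expandPos a x (-n) - 1) (by push_cast at hn; omega) (by omega)
    have key : ∀ z : ℤ → A, (z m = a → expand a ι b z (expandPos a z (-n) - 1) = b) ∧
        (z m ≠ a → expand a ι b z (expandPos a z (-n) - 1) = ι (z m)) := by
      intro z
      constructor <;> intro hz
      · rw [hm1, expandPos_succ_of_eq hz, add_sub_assoc]
        exact expand_pos_succ hz
      · rw [hm1, expandPos_succ_of_ne hz, add_sub_cancel_right, expand_pos]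
    have h4 : x m = x' m ∧ expandPos a x m = expandPos a x' m := by
      by_cases ha : x m = a <;> by_cases ha' : x' m = a
      · have e1 := expandPos_succ_of_eq ha
        have e2 := expandPos_succ_of_eq ha'
        rw [← hm1] at e1 e2
        exact ⟨ha.trans ha'.symm, by omega⟩
      · rw [(key x).1 ha, h1, (key x').2 ha'] at h3
        exact absurd ⟨_, h3.symm⟩ hb
      · rw [(key x).2 ha, h1, (key x').1 ha'] at h3
        exact absurd ⟨_, h3⟩ hb
      · have e1 := expandPos_succ_of_ne ha
        have e2 := expandPos_succ_of_ne ha'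
        rw [← hm1] at e1 e2
        rw [(key x).2 ha, h1, (key x').2 ha'] at h3
        exact ⟨hι h3, by omega⟩
    rw [← hm]
    refine ⟨h4.2, fun i hi hi' => ?_⟩
    rcases eq_or_lt_of_le hi with rfl | hi
    · exact h4.1
    · exact h2 i (by omega) hi'

theorem expand_injective : Function.Injective (expand a ι b) := by
  intro x x' h
  funext i
  rcases lt_or_ge i 0 with hi | hi
  · exact (eq_of_expand_eq_neg hι hb (N := 2 * i.natAbs) (fun p _ _ => congrFun h p) i.natAbs
      le_rfl).2 i (by omega) hi
  · lift i to ℕ using hi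
    exact (eq_of_expand_eq hι (fun p _ _ => congrFun h p) i (lt_add_one _)).2

end Injective

end Expand

end ShiftSpace

/-! ### Symbol expansion and the covers -/

namespace ShiftSpace

/-- The shift space `Y` is the symbol expansion of `X` at the letter `a`. -/
structure ExpansionData (X Y : ShiftSpace.{u}) (a : X.Alphabet) (ι : X.Alphabet → Y.Alphabet)
    (b : Y.Alphabet) : Prop where
  injective : Function.Injective ι
  notMem_range : b ∉ Set.range ι
  points_eq : Y.points = {y | ∃ x ∈ X.points, IsExpansionOf a ι b x y}

namespace ExpansionData

variable {X Y : ShiftSpace.{u}} {a : X.Alphabet} {ι : X.Alphabet → Y.Alphabet} {b : Y.Alphabet}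

local notation "E" => expand a ι b

theorem ne (h : ExpansionData X Y a ι b) (c : X.Alphabet) : ι c ≠ b :=
  fun hc => h.notMem_range ⟨c, hc⟩

theorem exists_eq_or (h : ExpansionData X Y a ι b) {y : ℤ → Y.Alphabet} (hy : y ∈ Y.points) :
    ∃ x ∈ X.points, y = E x ∨ x 0 = a ∧ y = shift 1 (E x) := by
  rw [h.points_eq] at hy
  obtain ⟨x, hx, hxy⟩ := hy
  obtain ⟨m, rfl⟩ := isExpansionOf_iff.1 hxy
  obtain ⟨n, -, hn | ⟨hn, hm⟩⟩ := exists_pos (a := a) x m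
  · exact ⟨shift n x, (shift_mem_iff n).2 hx, Or.inl (by rw [expand_shift, hn])⟩
  · refine ⟨shift n x, (shift_mem_iff n).2 hx, Or.inr ⟨by simpa using hn, ?_⟩⟩
    rw [expand_shift, hm, shift_add]

theorem exists_eq (h : ExpansionData X Y a ι b) {y : ℤ → Y.Alphabet} (hy : y ∈ Y.points)
    (h₀ : y 0 ≠ b) : ∃ x ∈ X.points, y = E x := by
  obtain ⟨x, hx, rfl | ⟨hxa, rfl⟩⟩ := h.exists_eq_or hy
  · exact ⟨x, hx, rfl⟩
  · exact absurd (expand_one hxa) h₀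

theorem expand_mem (h : ExpansionData X Y a ι b) {x : ℤ → X.Alphabet} :
    E x ∈ Y.points ↔ x ∈ X.points := by
  constructor
  · intro hx
    obtain ⟨x', hx', he⟩ := h.exists_eq hx (by rw [expand_zero]; exact h.ne _)
    rwa [expand_injective h.injective h.notMem_range he]
  · intro hx
    rw [h.points_eq]
    exact ⟨x, hx, isExpansionOf_iff.2 ⟨0, by simp⟩⟩

theorem succ_eq_of_eq (h : ExpansionData X Y a ι b) {y : ℤ → Y.Alphabet} (hy : y ∈ Y.points)
    {i : ℤ} (hi : y i = ι a) : y (i + 1) = b := by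
  obtain ⟨x, -, he⟩ := h.exists_eq ((shift_mem_iff i).2 hy) (by simpa [hi] using h.ne a)
  have h0 := congrFun he 0
  rw [shift_apply, add_zero, hi, expand_zero] at h0
  have h1 := congrFun he 1
  rwa [shift_apply, expand_one (h.injective h0.symm)] at h1

theorem eq_of_succ_eq (h : ExpansionData X Y a ι b) {y : ℤ → Y.Alphabet} (hy : y ∈ Y.points)
    {i : ℤ} (hi : y (i + 1) = b) : y i = ι a := by
  obtain ⟨x, -, he | ⟨hxa, he⟩⟩ := h.exists_eq_or ((shift_mem_iff (i + 1)).2 hy)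
  · have h0 := congrFun he 0
    rw [shift_apply, add_zero, hi, expand_zero] at h0
    exact absurd h0.symm (h.ne _)
  · have h0 := congrFun he (-1)
    rw [shift_apply, add_neg_cancel_right, shift_apply, add_neg_cancel, expand_zero, hxa] at h0
    exact h0

theorem splice_mem_iff (h : ExpansionData X Y a ι b) {u v : ℤ → X.Alphabet} :
    splice 0 (E u) (E v) ∈ Y.points ↔ splice 0 u v ∈ X.points := by
  rw [← expand_splice, h.expand_mem]

theorem splice_mem_iff_at (h : ExpansionData X Y a ι b) {u v : ℤ → X.Alphabet} {n : ℤ}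
    (hn : expandPos a u n = expandPos a v n) :
    splice (expandPos a v n) (E u) (E v) ∈ Y.points ↔ splice n u v ∈ X.points := by
  rw [← shift_mem_iff (expandPos a v n), shift_splice, sub_self, ← expand_shift, ← hn,
    ← expand_shift, h.splice_mem_iff, ← shift_mem_iff n (w := splice n u v), shift_splice, sub_self]

/-- A past that may precede a letter position is the past of an expansion, whatever future `z` is
then attached. -/
theorem exists_past_eq (h : ExpansionData X Y a ι b) {y : ℤ → Y.Alphabet} {w : ℤ → X.Alphabet}
    (hy : splice 0 y (E w) ∈ Y.points) : ∃ u, ∀ z, splice 0 y z = splice 0 (E u) z := by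
  obtain ⟨u, -, hu⟩ := h.exists_eq hy
    (by rw [splice_of_le le_rfl, expand_zero]; exact h.ne _)
  refine ⟨u, fun z => splice_eq (fun j hj => ?_) fun j hj => (splice_of_le hj).symm⟩
  rw [← hu, splice_of_lt hj, splice_of_lt hj]

theorem predAt_subset_iff_zero (h : ExpansionData X Y a ι b) {w w' : ℤ → X.Alphabet} :
    Y.predAt (E w) 0 ⊆ Y.predAt (E w') 0 ↔ X.predAt w 0 ⊆ X.predAt w' 0 := by
  rw [predAt_subset_iff, predAt_subset_iff]
  constructor
  · intro hs v hv
    exact h.splice_mem_iff.1 (hs _ (h.splice_mem_iff.2 hv))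
  · intro hs y hy
    obtain ⟨u, hu⟩ := h.exists_past_eq hy
    rw [hu] at hy ⊢
    exact h.splice_mem_iff.2 (hs _ (h.splice_mem_iff.1 hy))

theorem predAt_subset_iff (h : ExpansionData X Y a ι b) {w w' : ℤ → X.Alphabet} {n n' : ℤ} :
    Y.predAt (E w) (expandPos a w n) ⊆ Y.predAt (E w') (expandPos a w' n') ↔
      X.predAt w n ⊆ X.predAt w' n' := by
  have h1 := h.predAt_subset_iff_zero (w := shift n w) (w' := shift n' w')
  rwa [expand_shift, expand_shift, predAt_shift, predAt_shift, predAt_shift, predAt_shift,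
    add_zero, add_zero, add_zero, add_zero] at h1

theorem predAt_eq_iff (h : ExpansionData X Y a ι b) {w w' : ℤ → X.Alphabet} {n n' : ℤ} :
    Y.predAt (E w) (expandPos a w n) = Y.predAt (E w') (expandPos a w' n') ↔
      X.predAt w n = X.predAt w' n' := by
  rw [Set.Subset.antisymm_iff, Set.Subset.antisymm_iff, h.predAt_subset_iff, h.predAt_subset_iff]

theorem predAt_eq_iff_zero (h : ExpansionData X Y a ι b) {w w' : ℤ → X.Alphabet} :
    Y.predAt (E w) 0 = Y.predAt (E w') 0 ↔ X.predAt w 0 = X.predAt w' 0 :=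
  h.predAt_eq_iff (n := 0) (n' := 0)

/-- Inclusion and gluing at letter positions correspond in `X` and `Y`. The only extra vertices of
`Y` are those of futures starting with `b`. -/
theorem nonDecAt_zero_iff (h : ExpansionData X Y a ι b) {w : ℤ → X.Alphabet} :
    Y.NonDecAt (E w) 0 ↔ X.NonDecAt w 0 := by
  constructor
  · rintro ⟨hw, hd⟩
    refine ⟨h.expand_mem.1 hw, fun S hS h₁ h₂ => ?_⟩
    obtain ⟨_, ⟨q, hq, rfl⟩, hp⟩ := hd (expand a ι b '' S) (by
      rintro _ ⟨q, hq, rfl⟩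
      exact h.expand_mem.2 (hS hq)) (by
      rintro _ ⟨q, hq, rfl⟩
      exact h.predAt_subset_iff_zero.2 (h₁ q hq)) (by
      intro y hy
      obtain ⟨u, hu⟩ := h.exists_past_eq hy
      rw [hu] at hy
      obtain ⟨q, hq, hm⟩ := h₂ u (h.splice_mem_iff.1 hy)
      exact ⟨_, ⟨q, hq, rfl⟩, by rw [hu]; exact h.splice_mem_iff.2 hm⟩)
    exact ⟨q, hq, h.predAt_eq_iff_zero.1 hp⟩
  · rintro ⟨hw, hd⟩
    refine ⟨h.expand_mem.2 hw, fun S hS h₁ h₂ => ?_⟩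
    obtain ⟨q, hq, hp⟩ := hd {q | E q ∈ S} (fun q hq => h.expand_mem.1 (hS hq))
      (fun q hq => h.predAt_subset_iff_zero.1 (h₁ _ hq)) (by
      intro v hv
      have hv' := h.splice_mem_iff.2 hv
      obtain ⟨y, hy, hm⟩ := h₂ _ hv'
      -- A future starting with `b` forces the past to end in `ι a`; but then `b` would also have to
      -- begin `E w`, which begins with a renamed letter.
      obtain ⟨q, hq, rfl⟩ := h.exists_eq (hS hy) (by
        intro hb
        have h3 : E v (-1) = ι a := by
          have := h.eq_of_succ_eq (i := -1) hm (by simpa [splice] using hb)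
          simpa [splice] using this
        have h4 := h.succ_eq_of_eq (i := -1) hv' (by simpa [splice] using h3)
        rw [neg_add_cancel, splice_of_le le_rfl, expand_zero] at h4
        exact h.ne _ h4)
      exact ⟨q, hy, h.splice_mem_iff.1 hm⟩)
    exact ⟨_, hq, h.predAt_eq_iff_zero.2 hp⟩

theorem nonDecAt_iff (h : ExpansionData X Y a ι b) {w : ℤ → X.Alphabet} {n : ℤ} :
    Y.NonDecAt (E w) (expandPos a w n) ↔ X.NonDecAt w n := by
  have := h.nonDecAt_zero_iff (w := shift n w)
  rwa [expand_shift, nonDecAt_shift, nonDecAt_shift, add_zero, add_zero] at this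

theorem inFischer_zero (h : ExpansionData X Y a ι b) {w : ℤ → X.Alphabet}
    (hF : X.InFischer w 0) : Y.InFischer (E w) 0 := by
  obtain ⟨hw, w', hw', j, hj, hp, hd⟩ := hF
  exact ⟨h.expand_mem.2 hw, E w', h.expand_mem.2 hw', expandPos a w' j,
    expandPos_strictMono.monotone hj, h.predAt_eq_iff_zero.2 hp, h.nonDecAt_iff.2 hd⟩

/-- A vertex between `a` and the inserted `b` has no counterpart in `X`. It is the union of those
arising from non-decomposable vertices of `X` inside the vertex of `v` at `1`, reached through the
letter `a`. One of these gives the whole vertex, and prepending `a` identifies the vertices at `0`.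
-/
theorem inFischer_of_nonDecAt_one (h : ExpansionData X Y a ι b) [Finite X.kriegerCover.Vertex]
    {v : ℤ → X.Alphabet} (hva : v 0 = a) (hd : Y.NonDecAt (E v) 1) : X.InFischer v 0 := by
  have hv : v ∈ X.points := h.expand_mem.1 hd.1
  have h2 : ∀ {q : ℤ → X.Alphabet}, q 0 = a → expandPos a q 1 = 2 := fun hq => by
    have := expandPos_succ_of_eq hq
    rwa [expandPos_zero] at this
  obtain ⟨_, ⟨q, hq, hqa, hqd, -, rfl⟩, hp⟩ := hd.2 {y | ∃ q ∈ X.points, q 0 = a ∧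
      X.NonDecAt q 1 ∧ X.predAt q 1 ⊆ X.predAt v 1 ∧ E q = y} (by
    rintro _ ⟨q, hq, -, -, -, rfl⟩
    exact h.expand_mem.2 hq) (by
    rintro _ ⟨q, hq, hqa, -, hs, rfl⟩
    have h3 := h.predAt_subset_iff.2 hs
    rw [h2 hqa, h2 hva] at h3
    refine predAt_mono_left (by omega) h3 fun l hl hl' => ?_
    obtain rfl : l = 1 := by omega
    rw [expand_one hqa, expand_one hva]) (by
    intro y hy
    have h3 := h.eq_of_succ_eq (i := 0) hy (by
      rw [zero_add, splice_of_le le_rfl, expand_one hva])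
    obtain ⟨u, hu, he⟩ := h.exists_eq hy (by rw [h3]; exact h.ne a)
    have hua : u 0 = a := by
      rw [he, expand_zero] at h3
      exact h.injective h3
    have h4 : splice 1 u v ∈ X.points := by
      rw [← h.splice_mem_iff_at ((h2 hua).trans (h2 hva).symm), h2 hva]
      rw [splice_eq (u := E u) (fun _ _ => rfl) fun l hl => ?_]
      · exact h.expand_mem.2 hu
      · rw [← he, splice_of_le (by omega)]
    obtain ⟨q, hqd, hqs, hqm⟩ := exists_nonDecAt hv h4
    have h5 : splice 1 u q 0 = a := by rw [splice_of_lt (by omega), hua]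
    refine ⟨_, ⟨splice 1 u q, hqm, h5, hqd.congr hqm (predAt_splice le_rfl).symm,
      (predAt_splice le_rfl).le.trans hqs, rfl⟩, ?_⟩
    rw [splice_eq (u := E (splice 1 u q)) (fun l hl => ?_) fun _ _ => rfl]
    · exact h.expand_mem.2 hqm
    · rw [← splice_of_lt (v := y) (w := E v) hl, he]
      rcases eq_or_lt_of_le (show l ≤ 0 by omega) with rfl | hl'
      · rw [expand_zero, expand_zero, h5, hua]
      · exact expand_neg_congr (n := l.natAbs) (fun i _ hi => (splice_of_lt (by omega)).symm) hl'
          (by omega))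
  have h3 : X.predAt q 0 = X.predAt v 0 := by
    refine h.predAt_eq_iff_zero.1 (predAt_eq_left (by omega) hp fun l hl hl' => ?_)
    obtain rfl : l = 0 := by omega
    rw [expand_zero, expand_zero, hqa, hva]
  exact (hqd.inFischer.mono (by omega)).congr hv h3

theorem inFischer_zero_of_expand (h : ExpansionData X Y a ι b) [Finite X.kriegerCover.Vertex]
    {w : ℤ → X.Alphabet} (hF : Y.InFischer (E w) 0) : X.InFischer w 0 := by
  have hw := h.expand_mem.1 hF.1
  obtain ⟨y, hy, h₁, h₂, j, hj, hd⟩ := hF.exists_eq_left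
  -- The witness shares the past of `E w`, which does not end in `ι a`, so it cannot start with `b`.
  obtain ⟨v, hv, rfl⟩ := h.exists_eq hy (by
    intro hb
    have h3 := h.eq_of_succ_eq (i := -1) hy (by rwa [neg_add_cancel])
    rw [h₁ _ (by omega)] at h3
    have h4 := h.succ_eq_of_eq hF.1 h3
    rw [neg_add_cancel, expand_zero] at h4
    exact h.ne _ h4)
  refine InFischer.congr ?_ hw (h.predAt_eq_iff_zero.1 h₂)
  obtain ⟨n, hn, hc⟩ := exists_pos (a := a) v j
  have hn0 : 0 < n + 1 := (expandPos_strictMono (a := a) (x := v)).lt_iff_lt.1 (hj.trans_lt hn)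
  refine InFischer.mono (j := n) ?_ (by omega)
  rcases hc with rfl | ⟨hc, rfl⟩
  · exact (h.nonDecAt_iff.1 hd).inFischer
  · rw [← nonDecAt_shift, ← expand_shift] at hd
    have := h.inFischer_of_nonDecAt_one (by simpa using hc) hd
    rwa [inFischer_shift, add_zero] at this

theorem inFischer (h : ExpansionData X Y a ι b) {w : ℤ → X.Alphabet} {n : ℤ}
    (hF : X.InFischer w n) : Y.InFischer (E w) (expandPos a w n) := by
  have := h.inFischer_zero (w := shift n w) (by rwa [inFischer_shift, add_zero])
  rwa [expand_shift, inFischer_shift, add_zero] at this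

theorem inFischer_of_expand (h : ExpansionData X Y a ι b) [Finite X.kriegerCover.Vertex]
    {w : ℤ → X.Alphabet} {n : ℤ} (hF : Y.InFischer (E w) (expandPos a w n)) :
    X.InFischer w n := by
  have := h.inFischer_zero_of_expand (w := shift n w)
    (by rwa [expand_shift, inFischer_shift, add_zero])
  rwa [inFischer_shift, add_zero] at this

theorem expand_eq_of_window (N : ℕ) {w w' : ℤ → X.Alphabet}
    (hw : ∀ i : ℤ, i.natAbs ≤ N → w i = w' i) {p : ℤ} (hp : -N ≤ p)
    (hp' : p < expandPos a w (N + 1)) : E w p = E w' p := by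
  rcases lt_or_ge p 0 with h₀ | h₀
  · exact expand_neg_congr (n := N) (fun i hi hi' => hw i (by omega)) h₀ hp
  · exact expand_congr (n := N + 1) (fun i hi hi' => hw i (by push_cast at hi'; omega)) h₀
      (by push_cast; exact hp')

theorem le_expandPos_succ (N : ℕ) (w : ℤ → X.Alphabet) : (N : ℤ) + 1 ≤ expandPos a w (N + 1) := by
  have := le_expandPos (a := a) (x := w) (N + 1)
  push_cast at this
  exact this

theorem expandPos_succ_le (N : ℕ) (w : ℤ → X.Alphabet) :
    expandPos a w (N + 1) ≤ 2 * (N + 1) := by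
  have := expandPos_le (a := a) (x := w) (N + 1)
  push_cast at this
  exact this

theorem kAgree (h : ExpansionData X Y a ι b) {N : ℕ} {w w' : ℤ → X.Alphabet}
    (hK : X.KAgree N w w') : Y.KAgree N (E w) (E w') := by
  have hle := le_expandPos_succ (a := a) N w
  refine ⟨fun i hi => expand_eq_of_window N hK.1 (by omega) (by omega), ?_⟩
  have h1 : expandPos a w (N + 1) = expandPos a w' (N + 1) := by
    have := expandPos_congr (a := a) (x := w) (x' := w') (n := N + 1) fun i hi hi' =>
      hK.1 i (by push_cast at hi'; omega)
    push_cast at this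
    exact this
  have h2 := h.predAt_eq_iff.2 hK.2
  rw [← h1] at h2
  exact predAt_eq_left hle h2 fun l hl hl' => expand_eq_of_window N hK.1 (by omega) hl'

theorem kAgree_of_expand (h : ExpansionData X Y a ι b) {N : ℕ} {w w' : ℤ → X.Alphabet}
    (hK : Y.KAgree (2 * N + 2) (E w) (E w')) : X.KAgree N w w' := by
  have hE := hK.1
  have hpos : ∀ n : ℕ, n ≤ N + 1 → expandPos a w n = expandPos a w' n ∧ w n = w' n := by
    intro n hn
    -- The letter at `N + 1` sits at position at most `2 * N + 2`, still inside the window.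
    refine eq_of_expand_eq h.injective (N := 2 * N + 3) (fun p hp hp' => hE p (by omega)) n ?_
    have := expandPos_le (a := a) (x := w) n
    omega
  have hneg := eq_of_expand_eq_neg h.injective h.notMem_range (x := w) (x' := w')
    (N := 2 * N + 2) (fun p hp hp' => hE p (by omega)) N (by omega)
  refine ⟨fun i hi => ?_, h.predAt_eq_iff.1 ?_⟩
  · rcases lt_or_ge i 0 with h₀ | h₀
    · exact hneg.2 i (by omega) h₀
    · lift i to ℕ using h₀
      exact (hpos i (by omega)).2
  · have h1 := (hpos (N + 1) le_rfl).1
    push_cast at h1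
    rw [← h1]
    have h2 := expandPos_succ_le (a := a) N w
    have h3 := le_expandPos_succ (a := a) N w
    exact predAt_eq_left (by push_cast; omega) hK.2 fun l hl hl' => hE l (by push_cast at hl'; omega)

theorem orbitCode (h : ExpansionData X Y a ι b) :
    OrbitCode (fun x : X.points => (⟨E x, h.expand_mem.2 x.2⟩ : Y.points))
      (fun x => expandPos a (x : ℤ → X.Alphabet)) := by
  have hcont : Continuous fun x : X.points => (⟨E x, h.expand_mem.2 x.2⟩ : Y.points) := by
    refine Continuous.subtype_mk (continuous_pi fun p => ?_) _
    refine ((IsLocallyConstant.iff_eventually_eq _).2 fun x => ?_).continuous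
    refine mem_nhds_iff_window.2 ⟨p.natAbs, fun x' hx => ?_⟩
    have := le_expandPos_succ (a := a) p.natAbs (x' : ℤ → X.Alphabet)
    exact expand_eq_of_window p.natAbs hx (by omega) (by omega)
  have hinj : Function.Injective fun x : X.points => (⟨E x, h.expand_mem.2 x.2⟩ : Y.points) := by
    intro x x' he
    exact Subtype.ext (expand_injective h.injective h.notMem_range (congrArg Subtype.val he))
  refine ⟨hcont, ?_, fun _ => rfl, fun _ => expandPos_lt, fun {n x x'} hx => ?_,
    fun {n x x'} hx m => ?_, fun x n => ?_, fun y => ?_, fun {x x' m} hx => ?_⟩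
  · refine Topology.IsOpenEmbedding.isOpenMap ⟨(hcont.isClosedEmbedding hinj).isEmbedding, ?_⟩
    -- The map is not onto: its range is the clopen set of points that do not show `b` at `0`.
    have hr : (Set.range fun x : X.points => (⟨E x, h.expand_mem.2 x.2⟩ : Y.points)) =
        (fun y : Y.points => (y : ℤ → Y.Alphabet) 0) ⁻¹' {b}ᶜ := by
      ext y
      constructor
      · rintro ⟨x, rfl⟩
        change E x 0 ≠ b
        rw [expand_zero]
        exact h.ne _
      · intro hy
        obtain ⟨x, hx, he⟩ := h.exists_eq y.2 hy
        exact ⟨⟨x, hx⟩, Subtype.ext he.symm⟩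
    rw [hr]
    exact (isOpen_discrete _).preimage ((continuous_apply 0).comp continuous_subtype_val)
  · change E x' = shift _ (E x)
    rw [hx, expand_shift]
  · rw [hx, expandPos_shift]
  · refine mem_nhds_iff_window.2 ⟨n.natAbs, fun x' hx => ?_⟩
    change expandPos a (x' : ℤ → X.Alphabet) n = expandPos a (x : ℤ → X.Alphabet) n
    rcases Int.natAbs_eq n with hn | hn <;> rw [hn]
    · exact expandPos_congr fun i hi hi' => hx i (by omega)
    · exact expandPos_neg_congr fun i hi hi' => hx i (by omega)
  · obtain ⟨x, hx, he | ⟨-, he⟩⟩ := h.exists_eq_or y.2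
    · exact ⟨⟨x, hx⟩, 0, by rw [he]; simp⟩
    · exact ⟨⟨x, hx⟩, 1, he⟩
  · change E x' = shift m (E x) at hx
    obtain ⟨n, -, hn | ⟨hn, hm⟩⟩ := exists_pos (a := a) (x : ℤ → X.Alphabet) m
    · rw [hn, ← expand_shift] at hx
      exact ⟨n, hn.symm, expand_injective h.injective h.notMem_range hx⟩
    · have h0 := congrFun hx 0
      rw [shift_apply, add_zero, hm, expand_pos_succ hn, expand_zero] at h0
      exact absurd h0 (h.ne _)

theorem coverCode (h : ExpansionData X Y a ι b) :
    CoverCode (fun x : X.points => (⟨E x, h.expand_mem.2 x.2⟩ : Y.points))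
      (fun x => expandPos a (x : ℤ → X.Alphabet)) := by
  refine ⟨h.orbitCode, fun y => ?_, fun N => ⟨N, fun _ _ => h.kAgree⟩,
    fun N => ⟨2 * N + 2, fun _ _ => h.kAgree_of_expand⟩, fun _ N => ⟨N, fun w hF => ?_⟩,
    fun _ N => ⟨2 * N + 2, fun w hF => h.inFischer_of_expand (hF.mono ?_)⟩⟩
  · obtain ⟨x, hx, he | ⟨-, he⟩⟩ := h.exists_eq_or y.2
    · exact ⟨⟨x, hx⟩, 0, Or.inl rfl, by rw [he]; simp⟩
    · exact ⟨⟨x, hx⟩, 1, Or.inr rfl, he⟩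
  · exact (h.inFischer hF).mono (le_expandPos_succ N _)
  · have := expandPos_succ_le (a := a) N (w : ℤ → X.Alphabet)
    push_cast
    omega

end ExpansionData

theorem IsSymbolExpansion.exists_coverCode {X Y : ShiftSpace.{u}} (h : X.IsSymbolExpansion Y) :
    ∃ (f : X.points → Y.points) (k : X.points → ℤ → ℤ), CoverCode f k := by
  obtain ⟨a, ι, b, hι, hb, hY⟩ := h
  exact ⟨_, _, (ExpansionData.mk hι hb hY).coverCode⟩

end ShiftSpace

/-! ### Finiteness from soficity, and the chain of elementary moves -/

namespace ShiftSpace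

variable {X Y Z : ShiftSpace.{u}}

/-- The left Krieger cover of a sofic shift is finite. -/
theorem IsSofic.finite_vertex (h : X.IsSofic) : Finite X.kriegerCover.Vertex := by
  obtain ⟨Z, g, ⟨F, hF, hZ⟩, hg⟩ := h
  have hZ' : ∀ z, z ∈ Z.points ↔ ∀ w ∈ F, ¬ Occurs w z := fun z => by rw [hZ]; rfl
  obtain ⟨r, hr⟩ := exists_radius hg.continuous hg.shift_commuting
  obtain ⟨L, hL⟩ := (hF.image List.length).bddAbove
  -- `L` bounds the lengths of the forbidden words of the finite type cover and `r` is the radius of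
  -- the factor map.
  obtain ⟨M, hM⟩ : ∃ M, M = L + r := ⟨_, rfl⟩
  -- The future of `x` is classified by the central words of points of `Z` whose images have this
  -- future. Only finitely many values occur, and equal values allow a lift of any past of `x` to be
  -- continued into a lift over the future of `x'`.
  let D : X.points → Set (Set.Icc (-(M : ℤ)) M → Z.Alphabet) := fun x =>
    {p | ∃ u : Z.points, (∀ i : Set.Icc (-(M : ℤ)) M, (u : ℤ → Z.Alphabet) i = p i) ∧
      ∀ i, 0 ≤ i → (g u : ℤ → X.Alphabet) i = (x : ℤ → X.Alphabet) i}
  have hD : ∀ x x' : X.points, D x = D x' → X.predAt x 0 ⊆ X.predAt x' 0 := by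
    intro x x' hxx
    rw [predAt_subset_iff]
    intro v hv
    obtain ⟨u, hu⟩ := hg.surjective ⟨_, hv⟩
    have hu' : (g u : ℤ → X.Alphabet) = splice 0 v x := by rw [hu]
    have hmem : (fun i : Set.Icc (-(M : ℤ)) M => (u : ℤ → Z.Alphabet) i) ∈ D x :=
      ⟨u, fun _ => rfl, fun i hi => by rw [hu', splice_of_le hi]⟩
    rw [hxx] at hmem
    obtain ⟨u', hw, hgu⟩ := hmem
    have hw' : ∀ i : ℤ, -M ≤ i → i ≤ M → (u' : ℤ → Z.Alphabet) i = (u : ℤ → Z.Alphabet) i :=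
      fun i hi hi' => hw ⟨i, hi, hi'⟩
    have hleft : ∀ i : ℤ, i ≤ M → splice 0 (u : ℤ → Z.Alphabet) u' i = (u : ℤ → Z.Alphabet) i := by
      intro i hi
      rcases lt_or_ge i 0 with h | h
      · exact splice_of_lt h
      · rw [splice_of_le h, hw' i (by omega) hi]
    have hright : ∀ i : ℤ, -M ≤ i →
        splice 0 (u : ℤ → Z.Alphabet) u' i = (u' : ℤ → Z.Alphabet) i := by
      intro i hi
      rcases lt_or_ge i 0 with h | h
      · rw [splice_of_lt h, hw' i hi (by omega)]
      · exact splice_of_le h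
    have hs : splice 0 (u : ℤ → Z.Alphabet) u' ∈ Z.points := by
      have h₁ := (hZ' _).1 u.2
      have h₂ := (hZ' _).1 u'.2
      rw [hZ']
      rintro w hwF ⟨i, hi⟩
      have hlen : w.length ≤ L := hL ⟨w, hwF, rfl⟩
      -- A forbidden word is too short to leave the common window on both sides, so it would already
      -- occur in `u` or in `u'`.
      rcases lt_or_ge i (-M) with h | h
      · exact h₁ w hwF ⟨i, fun j => by rw [← hi j, hleft _ (by omega)]⟩
      · exact h₂ w hwF ⟨i, fun j => by rw [← hi j, hright _ (by omega)]⟩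
    have : splice 0 v (x' : ℤ → X.Alphabet) = g ⟨_, hs⟩ := by
      refine splice_eq (fun j hj => ?_) fun j hj => ?_
      · rw [← splice_of_lt (v := v) (w := (x : ℤ → X.Alphabet)) hj, ← hu']
        exact hr _ _ _ fun l _ hl => (hleft l (by omega)).symm
      · rw [← hgu j hj]
        exact hr _ _ _ fun l hl _ => (hright l (by omega)).symm
    rw [this]
    exact (g _).2
  refine finite_of_determined (V := fun x : X.points => vertexAt x.2 0) (D := D) (fun P => ?_)
    fun x x' hx => Subtype.ext ((hD x x' hx).antisymm (hD x' x hx.symm))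
  obtain ⟨z, hz, hP⟩ := exists_vertexAt P 0
  exact ⟨⟨z, hz⟩, Subtype.ext hP.symm⟩

variable (X Y) in
/-- The covering maps of the generalized left Fischer covers of `X` and `Y` are flow equivalent. -/
def CoversFlowEquivalent : Prop :=
  ∃ (φ : Suspension X.points ≃ₜ Suspension Y.points)
    (ψ : Suspension X.fischerCover.edgeShift ≃ₜ Suspension Y.fischerCover.edgeShift),
    IsFlowEquivalence φ ∧ IsFlowEquivalence ψ ∧
      φ ∘ X.coveringSuspension = Y.coveringSuspension ∘ ψ

theorem CoversFlowEquivalent.refl : X.CoversFlowEquivalent X :=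
  ⟨Homeomorph.refl _, Homeomorph.refl _, IsFlowEquivalence.refl, IsFlowEquivalence.refl, rfl⟩

theorem CoversFlowEquivalent.symm (h : X.CoversFlowEquivalent Y) : Y.CoversFlowEquivalent X := by
  obtain ⟨φ, ψ, hφ, hψ, hc⟩ := h
  refine ⟨φ.symm, ψ.symm, hφ.symm, hψ.symm, funext fun p => ?_⟩
  have := congrFun hc (ψ.symm p)
  simp only [Function.comp_apply, ψ.apply_symm_apply] at this ⊢
  rw [φ.symm_apply_eq, this]

theorem CoversFlowEquivalent.trans (h : X.CoversFlowEquivalent Y) (h' : Y.CoversFlowEquivalent Z) :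
    X.CoversFlowEquivalent Z := by
  obtain ⟨φ, ψ, hφ, hψ, hc⟩ := h
  obtain ⟨φ', ψ', hφ', hψ', hc'⟩ := h'
  refine ⟨φ.trans φ', ψ.trans ψ', hφ.trans hφ', hψ.trans hψ', funext fun p => ?_⟩
  have h1 := congrFun hc p
  have h2 := congrFun hc' (ψ p)
  simp only [Function.comp_apply, Homeomorph.trans_apply] at h1 h2 ⊢
  rw [h1, h2]

/-- Finiteness is stated as an equivalence so that it can travel along the chain in either direction
and reach the intermediate shift spaces. -/
theorem FlowEquivalent.coversFlowEquivalent (h : X.FlowEquivalent Y) :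
    (Finite X.kriegerCover.Vertex ↔ Finite Y.kriegerCover.Vertex) ∧
      (Finite X.kriegerCover.Vertex → X.CoversFlowEquivalent Y) := by
  induction h with
  | rel X Y h =>
    obtain ⟨f, k, hf⟩ := h.elim Conjugate.exists_coverCode IsSymbolExpansion.exists_coverCode
    exact ⟨hf.finite_iff, hf.exists_flowEquivalence⟩
  | refl X => exact ⟨Iff.rfl, fun _ => CoversFlowEquivalent.refl⟩
  | symm X Y _ ih => exact ⟨ih.1.symm, fun h => (ih.2 (ih.1.2 h)).symm⟩
  | trans X Y Z _ _ ih₁ ih₂ =>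
    exact ⟨ih₁.1.trans ih₂.1, fun h => (ih₁.2 h).trans (ih₂.2 (ih₁.1.1 h))⟩

end ShiftSpace

theorem mainTheorem5 (X₁ X₂ : ShiftSpace.{u}) (hX₁ : X₁.IsSofic) (hX₂ : X₂.IsSofic)
    (hX : X₁.FlowEquivalent X₂) :
    ∃ (φ : Suspension X₁.points ≃ₜ Suspension X₂.points)
      (ψ : Suspension X₁.fischerCover.edgeShift ≃ₜ Suspension X₂.fischerCover.edgeShift),
      IsFlowEquivalence φ ∧ IsFlowEquivalence ψ ∧
        φ ∘ X₁.coveringSuspension = X₂.coveringSuspension ∘ ψ := by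
  exact hX.coversFlowEquivalent.2 hX₁.finite_vertex
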